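/- Let $(B,g_B)$ and $(F,g_F)$ be (smooth, finite-dimensional, boundaryless) Riemannian manifolds, let $n=\dim F$, and let $f:B\to\,]0,+\infty[$ be a smooth function. Let $M=B\times_fF$ be the warped product, i.e. the manifold $B\times F$ with the metric $g=\pi^*g_B+(f\circ\pi)^2\sigma^*g_F$, where $\pi:M\to B$ and $\sigma:M\to F$ are the projections. For a smooth vector field $W$ on a Riemannian manifold with Levi-Civita connection $\nabla$ put $$\nabla^*\nabla W=\sum_i\big(\nabla_{\nabla_{e_i}e_i}W-\nabla_{e_i}\nabla_{e_i}W\big),$$ where $(e_i)$ is a local orthonormal frame; $W$ is called a harmonic vector field if $\nabla^*\nabla W=0$. Let $V_1$ be a smooth vector field on $B$ and $V_2$ a smooth vector field on $F$, and let $V=V_1+V_2$ be the vector field $V_{(p,q)}=\big((V_1)_p,(V_2)_q\big)$ on $M$ (the sum of the horizontal lift of $V_1$ and the vertical lift of $V_2$). Then $V$ is a harmonic vector field on $M$ if and only if the following two equations hold at every point $(p,q)\in B\times F$: $$\nabla^*\nabla V_1-\frac nf\nabla^B_{\operatorname{grad}f}V_1+\frac2f\,(\operatorname{div}^FV_2)\operatorname{grad}f+n\,\frac{V_1(f)}{f^2}\operatorname{grad}f=0,$$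 $$\frac1{f^2}\nabla^*\nabla V_2+\frac{\Delta^B f}{f}V_2+(1-n)\frac{(\operatorname{grad}f)(f)}{f^2}V_2=0.$$ Here functions and vector fields on $B$ are evaluated at $p$ and those on $F$ at $q$; $\nabla^*\nabla V_1$, $\operatorname{grad}f$ and the Levi-Civita connection $\nabla^B$ are taken on $(B,g_B)$, $\nabla^*\nabla V_2$ and the divergence $\operatorname{div}^FV_2=\sum_i g_F(e_i,\nabla^F_{e_i}V_2)$ ($(e_i)$ orthonormal) on $(F,g_F)$, and $\Delta^B f=-\operatorname{tr}H^f$, where $H^f(X,Y)=X(Y(f))-(\nabla^B_XY)(f)$ is the Hessian of $f$ on $(B,g_B)$. -/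

import Mathlib

open scoped Manifold ContDiff

noncomputable section

namespace WarpedHarmonic

section Riemannian

variable {E : Type*} [NormedAddCommGroup E] [NormedSpace ℝ E]
  {H : Type*} [TopologicalSpace H] {I : ModelWithCorners ℝ E H}
  {M : Type*} [TopologicalSpace M] [ChartedSpace H M]

/-- A (smooth) Riemannian metric on the manifold `M`. -/
abbrev Metric (I : ModelWithCorners ℝ E H) (M : Type*) [TopologicalSpace M] [ChartedSpace H M]
    [IsManifold I ∞ M] :=
  Bundle.ContMDiffRiemannianMetric (B := M) I ∞ E (fun p : M => TangentSpace I p)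

/-- A vector field on `M` is smooth if it is smooth as a section of the tangent bundle. -/
def SmoothVectorField (V : ∀ p : M, TangentSpace I p) [IsManifold I ∞ M] : Prop :=
  ContMDiff I I.tangent ∞ (fun p => (⟨p, V p⟩ : TangentBundle I M))

/-! ### Vector calculus of a metric on an open subset of a vector space -/

/-- The Christoffel operator of a metric `G` on (an open subset of) the vector space `E`:
`Γ_x(u, w)` is the vector with
`G_x(Γ_x(u, w), z) = ½ (D_u G (w, z) + D_w G (u, z) - D_z G (u, w))` for all `z`. -/
def christoffel (G : E → E →L[ℝ] E →L[ℝ] ℝ) (x u w : E) : E :=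
  (G x).inverse ((1 / 2 : ℝ) •
    (fderiv ℝ G x u w + fderiv ℝ G x w u - ((fderiv ℝ G x).flip u).flip w))

/-- The Levi-Civita connection `∇_X Y` of a metric `G` on (an open subset of) `E`. -/
def nabla (G : E → E →L[ℝ] E →L[ℝ] ℝ) (X Y : E → E) : E → E :=
  fun x => fderiv ℝ Y x (X x) + christoffel G x (X x) (Y x)

/-! ### Transport to and from the chart at a point -/

/-- The coordinate expression, in the chart at `p`, of a vector field on `M`. -/
def chartField (p : M) (V : ∀ q : M, TangentSpace I q) : E → E :=
  fun x => mfderiv I 𝓘(ℝ, E) (extChartAt I p) ((extChartAt I p).symm x)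
    (V ((extChartAt I p).symm x))

/-- The coordinates of a tangent vector at `p`, in the chart at `p`. -/
def toChart (p : M) (v : TangentSpace I p) : E :=
  mfderiv I 𝓘(ℝ, E) (extChartAt I p) p v

/-- The tangent vector at `p` with given coordinates in the chart at `p`. -/
def fromChart (p : M) (w : E) : TangentSpace I p :=
  show E from mfderiv 𝓘(ℝ, E) I (extChartAt I p).symm (extChartAt I p p) w

/-- The derivative at `x` of the inverse of the chart at `p`. -/
def chartSymmDeriv (I : ModelWithCorners ℝ E H) (p : M) (x : E) : E →L[ℝ] E :=
  mfderiv 𝓘(ℝ, E) I (extChartAt I p).symm x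

variable [IsManifold I ∞ M]

/-- The coordinate expression, in the chart at `p`, of the metric `g`. -/
def chartMetric (g : Metric I M) (p : M) : E → E →L[ℝ] E →L[ℝ] ℝ :=
  fun x =>
    let L : E →L[ℝ] E := chartSymmDeriv I p x
    let b : E →L[ℝ] E →L[ℝ] ℝ := g.inner ((extChartAt I p).symm x)
    b.bilinearComp L L

/-! ### Orthonormal bases -/

section
variable [FiniteDimensional ℝ E]

theorem exists_orthonormalBasis_aux {W : Type*} [AddCommGroup W] [Module ℝ W]
    [FiniteDimensional ℝ W] (β : W →ₗ[ℝ] W →ₗ[ℝ] ℝ) (hs : ∀ v w, β v w = β w v)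
    (hp : ∀ v, v ≠ 0 → 0 < β v v) :
    ∃ b : Module.Basis (Fin (Module.finrank ℝ W)) ℝ W,
      ∀ i j, β (b i) (b j) = if i = j then 1 else 0 := by
  let c : InnerProductSpace.Core ℝ W :=
    { inner := fun v w => β v w
      conj_inner_symm := fun v w => hs w v
      re_inner_nonneg := fun v => by
        rcases eq_or_ne v 0 with rfl | hv
        · simp
        · simpa using (hp v hv).le
      add_left := fun v w x => by simp
      smul_left := fun a v w => by simp
      definite := fun v h => by
        by_contra hv
        exact (hp v hv).ne' h }
  let : NormedAddCommGroup W := c.toNormedAddCommGroup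
  let : InnerProductSpace ℝ W := InnerProductSpace.ofCore c.toCore
  let o := stdOrthonormalBasis ℝ W
  refine ⟨o.toBasis, fun i j => ?_⟩
  have h := (orthonormal_iff_ite.mp o.orthonormal) i j
  rw [OrthonormalBasis.coe_toBasis]
  exact h

/-- Every tangent space of a Riemannian manifold has an orthonormal basis. -/
theorem exists_orthonormalBasis (g : Metric I M) (p : M) :
    ∃ b : Module.Basis (Fin (Module.finrank ℝ E)) ℝ (TangentSpace I p),
      ∀ i j, g.inner p (b i) (b j) = if i = j then 1 else 0 := by
  have : FiniteDimensional ℝ (TangentSpace I p) := inferInstanceAs (FiniteDimensional ℝ E)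
  exact exists_orthonormalBasis_aux (W := TangentSpace I p)
    (LinearMap.mk₂ ℝ (fun v w => g.inner p v w) (fun _ _ _ => by simp) (fun _ _ _ => by simp)
      (fun _ _ _ => by simp) (fun _ _ _ => by simp)) (g.symm p) (g.pos p)

/-- An orthonormal basis of `(T_p M, g_p)`. -/
def orthonormalBasisAt (g : Metric I M) (p : M) :
    Module.Basis (Fin (Module.finrank ℝ E)) ℝ (TangentSpace I p) :=
  Classical.choose (exists_orthonormalBasis g p)

theorem orthonormalBasisAt_inner (g : Metric I M) (p : M) (i j : Fin (Module.finrank ℝ E)) :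
    g.inner p (orthonormalBasisAt g p i) (orthonormalBasisAt g p j) = if i = j then 1 else 0 :=
  Classical.choose_spec (exists_orthonormalBasis g p) i j

end

/-! ### Differential operators of a Riemannian manifold -/

/-- `covDeriv g V p v` is `(∇_v V)(p)`, where `∇` is the Levi-Civita connection of `g`. -/
def covDeriv (g : Metric I M) (V : ∀ q : M, TangentSpace I q) (p : M) (v : TangentSpace I p) :
    TangentSpace I p :=
  fromChart p
    (nabla (chartMetric g p) (fun _ => toChart p v) (chartField p V) (extChartAt I p p))

/-- The derivative `v(f)` of a function `f` along a tangent vector `v` at `p`. -/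
def dirDeriv (f : M → ℝ) (p : M) (v : TangentSpace I p) : ℝ :=
  mfderiv I 𝓘(ℝ, ℝ) f p v

/-- The gradient of a function: `g(grad f, v) = v(f)`. -/
def gradient (g : Metric I M) (f : M → ℝ) (p : M) : TangentSpace I p :=
  (g.inner p).inverse (mfderiv I 𝓘(ℝ, ℝ) f p)

/-- The Hessian `H^f(u, w) = u(w(f)) - (∇_u w)(f)` at `p`; in the first two terms `u` and `w` are
extended to a neighbourhood of `p` as vector fields that are constant in the chart at `p`
(the value at `p` does not depend on the extension). -/
def hessian (g : Metric I M) (f : M → ℝ) (p : M) (u w : TangentSpace I p) : ℝ :=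
  let h : E → ℝ := f ∘ (extChartAt I p).symm
  let x : E := extChartAt I p p
  let U : E → E := fun _ => toChart p u
  let W : E → E := fun _ => toChart p w
  fderiv ℝ (fun y => fderiv ℝ h y (W y)) x (U x) - fderiv ℝ h x (nabla (chartMetric g p) U W x)

variable [FiniteDimensional ℝ E]

/-- The divergence `div V = ∑ᵢ g(eᵢ, ∇_{eᵢ} V)`, `(eᵢ)` an orthonormal basis of `T_p M`. -/
def divergence (g : Metric I M) (V : ∀ q : M, TangentSpace I q) (p : M) : ℝ :=
  ∑ i, g.inner p (orthonormalBasisAt g p i) (covDeriv g V p (orthonormalBasisAt g p i))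

/-- The Laplacian `Δ f = - tr H^f` (with the sign that makes it a nonnegative operator). -/
def laplacian (g : Metric I M) (f : M → ℝ) (p : M) : ℝ :=
  -∑ i, hessian g f p (orthonormalBasisAt g p i) (orthonormalBasisAt g p i)

/-- The rough Laplacian `∇*∇V = ∑ᵢ (∇_{∇_{eᵢ} eᵢ} V - ∇_{eᵢ} ∇_{eᵢ} V)`, where `(eᵢ)` is an
orthonormal basis of `T_p M`, extended to a neighbourhood of `p` by vector fields that are constant
in the chart at `p` (each summand is tensorial in `eᵢ`: its value at `p` does not depend on the
extension). -/
def roughLaplacian (g : Metric I M) (V : ∀ q : M, TangentSpace I q) (p : M) : TangentSpace I p :=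
  let G : E → E →L[ℝ] E →L[ℝ] ℝ := chartMetric g p
  let e : Fin (Module.finrank ℝ E) → E → E := fun i _ => toChart p (orthonormalBasisAt g p i)
  let W : E → E := chartField p V
  fromChart p
    (∑ i, (nabla G (nabla G (e i) (e i)) W - nabla G (e i) (nabla G (e i) W)) (extChartAt I p p))

/-- `V` is a harmonic vector field on `(M, g)`: a smooth vector field with `∇*∇V = 0`. -/
def IsHarmonicVectorField (g : Metric I M) (V : ∀ q : M, TangentSpace I q) : Prop :=
  SmoothVectorField V ∧ ∀ p, roughLaplacian g V p = 0

end Riemannian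

/-! ### Warped products -/

section Warped

variable {E : Type*} [NormedAddCommGroup E] [NormedSpace ℝ E]
  {H : Type*} [TopologicalSpace H] {I : ModelWithCorners ℝ E H}
  {B : Type*} [TopologicalSpace B] [ChartedSpace H B] [IsManifold I ∞ B]
  {E' : Type*} [NormedAddCommGroup E'] [NormedSpace ℝ E']
  {H' : Type*} [TopologicalSpace H'] {J : ModelWithCorners ℝ E' H'}
  {F : Type*} [TopologicalSpace F] [ChartedSpace H' F] [IsManifold J ∞ F]

/-- The horizontal lift to `B × F` of a vector field on `B`. -/
def horizontalLift (V : ∀ p : B, TangentSpace I p) (z : B × F) : TangentSpace (I.prod J) z :=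
  ((V z.1, 0) : E × E')

/-- The vertical lift to `B × F` of a vector field on `F`. -/
def verticalLift (V : ∀ q : F, TangentSpace J q) (z : B × F) : TangentSpace (I.prod J) z :=
  ((0, V z.2) : E × E')

/-- The bilinear form `π^* g_B + (f ∘ π)² σ^* g_F` on `T_z (B × F)`. -/
def warpedInner (gB : Metric I B) (gF : Metric J F) (f : B → ℝ) (z : B × F) :
    TangentSpace (I.prod J) z →L[ℝ] TangentSpace (I.prod J) z →L[ℝ] ℝ :=
  let P : E × E' →L[ℝ] E := mfderiv (I.prod J) I (Prod.fst : B × F → B) z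
  let Q : E × E' →L[ℝ] E' := mfderiv (I.prod J) J (Prod.snd : B × F → F) z
  let bB : E →L[ℝ] E →L[ℝ] ℝ := gB.inner z.1
  let bF : E' →L[ℝ] E' →L[ℝ] ℝ := gF.inner z.2
  show E × E' →L[ℝ] E × E' →L[ℝ] ℝ from
    bB.bilinearComp P P + (f z.1) ^ 2 • bF.bilinearComp Q Q

theorem warpedInner_apply (gB : Metric I B) (gF : Metric J F) (f : B → ℝ) (z : B × F)
    (v w : TangentSpace (I.prod J) z) :
    warpedInner gB gF f z v w =
      gB.inner z.1 v.1 w.1 + (f z.1) ^ 2 * gF.inner z.2 v.2 w.2 := by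
  simp only [warpedInner, mfderiv_fst, mfderiv_snd]
  rfl

theorem metric_nonneg (gB : Metric I B) (p : B) (v : TangentSpace I p) :
    0 ≤ gB.inner p v v := by
  by_cases h : v = 0
  · rw [h]; simp
  · exact (gB.pos _ _ h).le

theorem warpedInner_symm (gB : Metric I B) (gF : Metric J F) (f : B → ℝ)
    (z : B × F) (v w : TangentSpace (I.prod J) z) :
    warpedInner gB gF f z v w = warpedInner gB gF f z w v := by
  rw [warpedInner_apply, warpedInner_apply]
  exact congrArg₂ (fun a b => a + (f z.1) ^ 2 * b) (gB.symm z.1 v.1 w.1) (gF.symm z.2 v.2 w.2)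

theorem warpedInner_pos (gB : Metric I B) (gF : Metric J F) (f : B → ℝ) (hpos : ∀ x, 0 < f x)
    (z : B × F) (v : TangentSpace (I.prod J) z) (hv : v ≠ 0) : 0 < warpedInner gB gF f z v v := by
  rw [warpedInner_apply]
  have hf2 : 0 < f z.1 ^ 2 := by have := hpos z.1; positivity
  by_cases h2 : v.2 = 0
  · have h1 : v.1 ≠ 0 := fun h1 => hv (Prod.ext h1 h2)
    exact add_pos_of_pos_of_nonneg (gB.pos z.1 v.1 h1)
      (mul_nonneg hf2.le (metric_nonneg gF z.2 v.2))
  · exact add_pos_of_nonneg_of_pos (metric_nonneg gB z.1 v.1)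
      (mul_pos hf2 (gF.pos z.2 v.2 h2))

theorem isVonNBounded_prod {b : E →L[ℝ] E →L[ℝ] ℝ} {b' : E' →L[ℝ] E' →L[ℝ] ℝ} {c : ℝ}
    (hc : c ≠ 0) (hb : ∀ v, 0 ≤ b v v) (hb' : ∀ v, 0 ≤ b' v v)
    (h1 : Bornology.IsVonNBounded ℝ {v : E | b v v < 1})
    (h2 : Bornology.IsVonNBounded ℝ {v : E' | b' v v < 1}) :
    Bornology.IsVonNBounded ℝ {v : E × E' | b v.1 v.1 + c ^ 2 * b' v.2 v.2 < 1} := by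
  have h3 : Bornology.IsVonNBounded ℝ ((fun v : E' => c⁻¹ • v) '' {v : E' | b' v v < 1}) :=
    h2.image (c⁻¹ • ContinuousLinearMap.id ℝ E')
  have h4 : Bornology.IsVonNBounded ℝ ({v : E | b v v < 1} ×ˢ
      ((fun v : E' => c⁻¹ • v) '' {v : E' | b' v v < 1})) := by
    rw [NormedSpace.isVonNBounded_iff] at h1 h3 ⊢
    exact h1.prod h3
  refine h4.subset ?_
  rintro ⟨x, y⟩ hv
  have hv' : b x x + c ^ 2 * b' y y < 1 := hv
  have hx := hb x
  have hy := mul_nonneg (sq_nonneg c) (hb' y)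
  refine ⟨?_, c • y, ?_, ?_⟩
  · show b x x < 1
    linarith
  · show b' (c • y) (c • y) < 1
    have : b' (c • y) (c • y) = c ^ 2 * b' y y := by
      simp; ring
    rw [this]; linarith
  · simp [smul_smul, inv_mul_cancel₀ hc]

theorem warpedInner_isVonNBounded (gB : Metric I B) (gF : Metric J F) (f : B → ℝ)
    (hpos : ∀ x, 0 < f x) (z : B × F) :
    Bornology.IsVonNBounded ℝ
      {v : TangentSpace (I.prod J) z | warpedInner gB gF f z v v < 1} := by
  have h : Bornology.IsVonNBounded ℝ {v : TangentSpace (I.prod J) z |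
      gB.inner z.1 v.1 v.1 + (f z.1) ^ 2 * gF.inner z.2 v.2 v.2 < 1} :=
    isVonNBounded_prod (E := E) (E' := E') (hpos z.1).ne' (metric_nonneg gB z.1)
      (metric_nonneg gF z.2) (gB.isVonNBounded z.1) (gF.isVonNBounded z.2)
  refine h.subset fun v hv => ?_
  rw [Set.mem_ofPred_eq, warpedInner_apply] at hv
  exact hv

/-- A map into bilinear forms on a finite-dimensional space is smooth if all its values are. -/
theorem contMDiffAt_bilin {W : Type*} [NormedAddCommGroup W] [NormedSpace ℝ W]
    [FiniteDimensional ℝ W] {E₀ : Type*} [NormedAddCommGroup E₀] [NormedSpace ℝ E₀]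
    {H₀ : Type*} [TopologicalSpace H₀] {K : ModelWithCorners ℝ E₀ H₀}
    {M : Type*} [TopologicalSpace M] [ChartedSpace H₀ M]
    (φ : M → W →L[ℝ] W →L[ℝ] ℝ) (x : M)
    (h : ∀ u w, ContMDiffAt K 𝓘(ℝ, ℝ) ∞ (fun y => φ y u w) x) :
    ContMDiffAt K 𝓘(ℝ, W →L[ℝ] W →L[ℝ] ℝ) ∞ φ x := by
  let b := Module.finBasis ℝ W
  let c : Fin (Module.finrank ℝ W) → W →L[ℝ] ℝ := fun i =>
    LinearMap.toContinuousLinearMap (b.coord i)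
  let T : Fin (Module.finrank ℝ W) → Fin (Module.finrank ℝ W) → W →L[ℝ] W →L[ℝ] ℝ :=
    fun i j => (c i).smulRight (c j)
  have hT : ∀ β : W →L[ℝ] W →L[ℝ] ℝ, β = ∑ i, ∑ j, β (b i) (b j) • T i j := by
    intro β
    ext v w
    conv_lhs => rw [← b.sum_repr v, ← b.sum_repr w]
    simp only [map_sum, map_smul, sum_apply, smul_apply,
      smul_eq_mul, T, c, ContinuousLinearMap.smulRight_apply,
      LinearMap.coe_toContinuousLinearMap', Module.Basis.coord_apply, Finset.mul_sum]
    rw [Finset.sum_comm]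
    refine Finset.sum_congr rfl fun i _ => Finset.sum_congr rfl fun j _ => ?_
    ring
  have hsum : ContMDiffAt K 𝓘(ℝ, W →L[ℝ] W →L[ℝ] ℝ) ∞
      (fun y => ∑ i, ∑ j, φ y (b i) (b j) • T i j) x :=
    contMDiffAt_finsetSum fun i _ => contMDiffAt_finsetSum fun j _ =>
      (h (b i) (b j)).smul contMDiffAt_const
  exact hsum.congr_of_eventuallyEq (Filter.Eventually.of_forall fun y => hT (φ y))

variable [FiniteDimensional ℝ E] [FiniteDimensional ℝ E']

theorem warpedInner_contMDiff (gB : Metric I B) (gF : Metric J F) (f : B → ℝ)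
    (hf : ContMDiff I 𝓘(ℝ, ℝ) ∞ f) :
    ContMDiff (I.prod J) ((I.prod J).prod 𝓘(ℝ, (E × E') →L[ℝ] (E × E') →L[ℝ] ℝ)) ∞
      (fun z : B × F => Bundle.TotalSpace.mk' ((E × E') →L[ℝ] (E × E') →L[ℝ] ℝ)
        (E := fun z : B × F =>
          TangentSpace (I.prod J) z →L[ℝ] TangentSpace (I.prod J) z →L[ℝ] ℝ)
        z (warpedInner gB gF f z)) := by
  intro z₀
  rw [contMDiffAt_hom_bundle]
  refine ⟨contMDiffAt_id, ?_⟩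
  apply contMDiffAt_bilin
  intro u w
  let e := trivializationAt (E × E') (TangentSpace (I.prod J) : B × F → Type _) z₀
  have hz₀ : z₀ ∈ e.baseSet := FiberBundle.mem_baseSet_trivializationAt' z₀
  have hs : ∀ u : E × E', ContMDiffAt (I.prod J) (I.prod J).tangent ∞
      (fun z => (⟨z, e.symmL ℝ z u⟩ : TangentBundle (I.prod J) (B × F))) z₀ := by
    intro u
    refine (e.contMDiffAt_section_iff hz₀).2 ?_
    refine (contMDiffAt_const (c := u)).congr_of_eventuallyEq ?_
    filter_upwards [e.open_baseSet.mem_nhds hz₀] with z hz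
    rw [e.symmL_apply hz]
    have h := e.apply_mk_symm hz u
    exact congrArg Prod.snd h
  have h1 : ∀ u : E × E', ContMDiffAt (I.prod J) I.tangent ∞
      (fun z => (⟨z.1, (e.symmL ℝ z u).1⟩ : TangentBundle I B)) z₀ := by
    intro u
    have := (contMDiff_fst.contMDiff_tangentMap (m := ∞) (n := ∞)
      (I := I.prod J) (I' := I) (f := (Prod.fst : B × F → B)) le_rfl).contMDiffAt.comp z₀ (hs u)
    refine this.congr_of_eventuallyEq (Filter.Eventually.of_forall fun z => ?_)
    simp [tangentMap]; rfl
  have h2 : ∀ u : E × E', ContMDiffAt (I.prod J) J.tangent ∞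
      (fun z => (⟨z.2, (e.symmL ℝ z u).2⟩ : TangentBundle J F)) z₀ := by
    intro u
    have := (contMDiff_snd.contMDiff_tangentMap (m := ∞) (n := ∞)
      (I := I.prod J) (I' := J) (f := (Prod.snd : B × F → F)) le_rfl).contMDiffAt.comp z₀ (hs u)
    refine this.congr_of_eventuallyEq (Filter.Eventually.of_forall fun z => ?_)
    simp [tangentMap]; rfl
  have hB : ContMDiffAt (I.prod J) 𝓘(ℝ, ℝ) ∞
      (fun z : B × F => gB.inner z.1 (e.symmL ℝ z u).1 (e.symmL ℝ z w).1) z₀ := by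
    have hg := (gB.contMDiff.contMDiffAt (x := z₀.1)).comp z₀
      (contMDiffAt_fst (I := I) (J := J) (n := ∞))
    have := ContMDiffAt.clm_bundle_apply₂ (F₁ := E) (F₂ := E) (F₃ := ℝ) (b := fun z : B × F => z.1)
      (E₁ := (TangentSpace I : B → Type _)) (E₂ := (TangentSpace I : B → Type _))
      (E₃ := Bundle.Trivial B ℝ) hg (h1 u) (h1 w)
    exact (Bundle.contMDiffAt_totalSpace.1 this).2
  have hF : ContMDiffAt (I.prod J) 𝓘(ℝ, ℝ) ∞
      (fun z : B × F => gF.inner z.2 (e.symmL ℝ z u).2 (e.symmL ℝ z w).2) z₀ := by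
    have hg := (gF.contMDiff.contMDiffAt (x := z₀.2)).comp z₀
      (contMDiffAt_snd (I := I) (J := J) (n := ∞))
    have := ContMDiffAt.clm_bundle_apply₂ (F₁ := E') (F₂ := E') (F₃ := ℝ)
      (b := fun z : B × F => z.2)
      (E₁ := (TangentSpace J : F → Type _)) (E₂ := (TangentSpace J : F → Type _))
      (E₃ := Bundle.Trivial F ℝ) hg (h2 u) (h2 w)
    exact (Bundle.contMDiffAt_totalSpace.1 this).2
  have hf' : ContMDiffAt (I.prod J) 𝓘(ℝ, ℝ) ∞ (fun z : B × F => f z.1 ^ 2) z₀ :=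
    (hf.comp contMDiff_fst).contMDiffAt.pow 2
  refine (hB.add (hf'.mul hF)).congr_of_eventuallyEq ?_
  filter_upwards [e.open_baseSet.mem_nhds hz₀] with z hz
  have key := inCoordinates_apply_eq₂ (𝕜 := ℝ) (F₁ := E × E') (F₂ := E × E') (F₃ := ℝ)
    (E₁ := (TangentSpace (I.prod J) : B × F → Type _))
    (E₂ := (TangentSpace (I.prod J) : B × F → Type _))
    (E₃ := Bundle.Trivial (B × F) ℝ) (x₀ := z₀) (x := z)
    (ϕ := warpedInner gB gF f z) (v := u) (w := w) hz hz (Set.mem_univ _)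
  refine key.trans ?_
  rw [← e.symmL_apply (R := ℝ) hz u, ← e.symmL_apply (R := ℝ) hz w]
  have h := warpedInner_apply gB gF f z (e.symmL ℝ z u) (e.symmL ℝ z w)
  simpa using h

/-- The metric `g = π^* g_B + (f ∘ π)² σ^* g_F` of the warped product `B ×_f F`. -/
def warpedMetric (gB : Metric I B) (gF : Metric J F) (f : B → ℝ)
    (hf : ContMDiff I 𝓘(ℝ, ℝ) ∞ f) (hpos : ∀ x, 0 < f x) : Metric (I.prod J) (B × F) where
  inner := warpedInner gB gF f
  symm := warpedInner_symm gB gF f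
  pos := warpedInner_pos gB gF f hpos
  isVonNBounded := warpedInner_isVonNBounded gB gF f hpos
  contMDiff := warpedInner_contMDiff gB gF f hf

end Warped

end WarpedHarmonic

end

open scoped Manifold ContDiff Topology

noncomputable section

set_option maxSynthPendingDepth 3

namespace WarpedHarmonic

/-! ### Traces over orthonormal bases -/

section Trace

variable {W X ι κ : Type*} [AddCommGroup W] [Module ℝ W] [AddCommGroup X] [Module ℝ X]
  [Fintype ι] [Fintype κ]

/-! The two equations are the base and fibre components of the rough Laplacian of `V₁ + V₂` at `(p,
q)`, so the theorem reduces to the pointwise formula `roughLaplacian_warpedMetric`.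

That formula is computed in the product of the charts at `p` and `q`, where the metric becomes
`warpedLocal` and the field becomes `(W₁, W₂)`. The Koszul formula gives the Christoffel operator
(`christoffel_warpedLocal`), with two mixed terms: `-φ GF(u₂, w₂) grad φ` in the base, and the
logarithmic derivatives of `φ` in the fibre.

The second covariant derivative is bilinear in its two directions (`secondNablaBilin`), so its trace
may be taken in any orthonormal basis (`sum_bilin_orthonormal_eq`). The convenient one joins an
orthonormal basis of the base to `φ⁻¹` times one of the fibre. Horizontal directions contribute the
Laplacian of `W₁` and the Hessian of `φ` (`secondNabla_base`). Vertical ones contribute the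
Laplacian of `W₂`, the divergence and the terms in `grad φ` (`secondNabla_fiber`). `sum_secondNabla`
adds them up. -/

theorem repr_eq_of_orthonormal [DecidableEq ι] (β : W →ₗ[ℝ] W →ₗ[ℝ] ℝ)
    (b : Module.Basis ι ℝ W)
    (hb : ∀ i j, β (b i) (b j) = if i = j then 1 else 0) (v : W) (i : ι) :
    b.repr v i = β (b i) v := by
  conv_rhs => rw [← b.sum_repr v]
  simp only [map_sum, map_smul, hb]
  simp

/-- The trace of a bilinear map does not depend on the orthonormal basis used to compute it. -/
theorem sum_bilin_orthonormal_eq [DecidableEq ι] [DecidableEq κ] (β : W →ₗ[ℝ] W →ₗ[ℝ] ℝ)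
    (hs : ∀ v w, β v w = β w v) (b : Module.Basis ι ℝ W) (c : Module.Basis κ ℝ W)
    (hb : ∀ i j, β (b i) (b j) = if i = j then 1 else 0)
    (hc : ∀ i j, β (c i) (c j) = if i = j then 1 else 0) (T : W →ₗ[ℝ] W →ₗ[ℝ] X) :
    ∑ i, T (b i) (b i) = ∑ j, T (c j) (c j) := by
  have h1 : ∀ i, T (b i) (b i) = ∑ j, ∑ k, (β (b i) (c j) * β (b i) (c k)) • T (c j) (c k) := by
    intro i
    conv_lhs => rw [← c.sum_repr (b i)]
    simp only [map_sum, map_smul, LinearMap.sum_apply, LinearMap.smul_apply,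
      repr_eq_of_orthonormal β c hc, Finset.smul_sum, smul_smul]
    rw [Finset.sum_comm]
    refine Finset.sum_congr rfl fun j _ => Finset.sum_congr rfl fun k _ => ?_
    rw [hs (b i), hs (b i), mul_comm]
  -- Parseval in the basis `b`: the change-of-basis matrix is orthogonal.
  have h2 : ∀ j k, ∑ i, β (b i) (c j) * β (b i) (c k) = if j = k then 1 else 0 := by
    intro j k
    rw [← hc j k]
    conv_rhs => rw [← b.sum_repr (c j)]
    simp [repr_eq_of_orthonormal β b hb]
  calc ∑ i, T (b i) (b i)
      = ∑ j, ∑ k, (∑ i, β (b i) (c j) * β (b i) (c k)) • T (c j) (c k) := by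
        simp only [h1, Finset.sum_smul]
        rw [Finset.sum_comm]
        exact Finset.sum_congr rfl fun j _ => Finset.sum_comm
    _ = _ := by simp [h2]

end Trace

/-! ### The Levi-Civita connection of a metric on a vector space -/

section Local

variable {E : Type*} [NormedAddCommGroup E] [NormedSpace ℝ E]

theorem two_le_smooth : (1 : WithTop ℕ∞) + 1 ≤ ∞ := by
  rw [show (1 : WithTop ℕ∞) + 1 = ((2 : ℕ∞) : WithTop ℕ∞) by norm_num]
  exact_mod_cast le_top

theorem differentiableAt_flip {X : Type*} [NormedAddCommGroup X] [NormedSpace ℝ X]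
    {A : E → E →L[ℝ] E →L[ℝ] X} {x : E} (h : DifferentiableAt ℝ A x) :
    DifferentiableAt ℝ (fun x => (A x).flip) x :=
  DifferentiableAt.comp (g := ContinuousLinearMap.flipₗᵢ ℝ E E X) x
    (ContinuousLinearMap.flipₗᵢ ℝ E E X).differentiableAt h

theorem fderiv_apply_apply {G : E → E →L[ℝ] E →L[ℝ] ℝ} {x : E} (hx : DifferentiableAt ℝ G x)
    (z u w : E) : fderiv ℝ G x z u w = fderiv ℝ (fun y => G y u w) x z := by
  have h1 : HasFDerivAt (fun y => G y u w) _ x :=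
    (hx.hasFDerivAt.clm_apply (hasFDerivAt_const u x)).clm_apply (hasFDerivAt_const w x)
  rw [h1.fderiv]
  simp

/-- `G` is a metric near `x₀`: smooth, symmetric and positive definite. -/
structure IsLocalMetric (G : E → E →L[ℝ] E →L[ℝ] ℝ) (x₀ : E) : Prop where
  symm : ∀ x u w, G x u w = G x w u
  pos : ∀ᶠ x in 𝓝 x₀, ∀ v, v ≠ 0 → 0 < G x v v
  contDiffAt : ContDiffAt ℝ ∞ G x₀

theorem ext_of_pos {b : E →L[ℝ] E →L[ℝ] ℝ} (hb : ∀ v, v ≠ 0 → 0 < b v v) {v w : E}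
    (h : ∀ z, b v z = b w z) : v = w := by
  by_contra hne
  have := hb (v - w) (sub_ne_zero.2 hne)
  simp [h] at this

section
variable [FiniteDimensional ℝ E]

/-- Definiteness makes the map to the dual injective, and the dimensions agree. This is what gives
`inverse`, which is zero on non-invertible maps, its meaning in `christoffel` and `gradLocal`. -/
theorem isInvertible_of_pos {b : E →L[ℝ] E →L[ℝ] ℝ} (hb : ∀ v, v ≠ 0 → 0 < b v v) :
    b.IsInvertible := by
  have hinj : Function.Injective b := by
    rw [injective_iff_map_eq_zero]
    intro v hv
    by_contra h
    have := hb v h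
    simp [hv] at this
  have hfr : Module.finrank ℝ E = Module.finrank ℝ (E →L[ℝ] ℝ) := by
    rw [← (LinearMap.toContinuousLinearMap (𝕜 := ℝ) (E := E) (F' := ℝ)).finrank_eq]
    exact Subspace.dual_finrank_eq.symm
  exact ⟨(LinearEquiv.ofInjectiveOfFinrankEq b.toLinearMap hinj hfr).toContinuousLinearEquiv,
    by ext; rfl⟩

theorem apply_inverse_of_pos {b : E →L[ℝ] E →L[ℝ] ℝ} (hb : ∀ v, v ≠ 0 → 0 < b v v)
    (η : E →L[ℝ] ℝ) : b (b.inverse η) = η :=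
  (isInvertible_of_pos hb).self_apply_inverse η

theorem christoffel_spec {G : E → E →L[ℝ] E →L[ℝ] ℝ} {x : E} (hx : ∀ v, v ≠ 0 → 0 < G x v v)
    (u w z : E) :
    G x (christoffel G x u w) z =
      (1 / 2 : ℝ) * (fderiv ℝ G x u w z + fderiv ℝ G x w u z - fderiv ℝ G x z u w) := by
  rw [christoffel, apply_inverse_of_pos hx]
  simp

/-- Uniqueness in the Koszul formula: a candidate for the Christoffel operator only has to be tested
against all vectors. -/
theorem christoffel_eq_of_spec {G : E → E →L[ℝ] E →L[ℝ] ℝ} {x : E}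
    (hx : ∀ v, v ≠ 0 → 0 < G x v v) {u w c : E}
    (hc : ∀ z, G x c z =
      (1 / 2 : ℝ) * (fderiv ℝ G x u w z + fderiv ℝ G x w u z - fderiv ℝ G x z u w)) :
    christoffel G x u w = c :=
  ext_of_pos hx fun z => by rw [christoffel_spec hx, hc]
end

/-- No condition on `G` is needed: `inverse` is a linear map even where it takes its default value.
-/
theorem christoffel_add_left (G : E → E →L[ℝ] E →L[ℝ] ℝ) (x u u' w : E) :
    christoffel G x (u + u') w = christoffel G x u w + christoffel G x u' w := by
  rw [christoffel, christoffel, christoffel, ← map_add, ← smul_add]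
  congr 2
  ext z
  simp
  ring

theorem christoffel_add_right (G : E → E →L[ℝ] E →L[ℝ] ℝ) (x u w w' : E) :
    christoffel G x u (w + w') = christoffel G x u w + christoffel G x u w' := by
  rw [christoffel, christoffel, christoffel, ← map_add, ← smul_add]
  congr 2
  ext z
  simp
  ring

theorem christoffel_smul_left (G : E → E →L[ℝ] E →L[ℝ] ℝ) (x : E) (c : ℝ) (u w : E) :
    christoffel G x (c • u) w = c • christoffel G x u w := by
  rw [christoffel, christoffel, ← map_smul, smul_comm c]
  congr 2
  ext z
  simp
  ring

theorem christoffel_smul_right (G : E → E →L[ℝ] E →L[ℝ] ℝ) (x : E) (c : ℝ) (u w : E) :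
    christoffel G x u (c • w) = c • christoffel G x u w := by
  rw [christoffel, christoffel, ← map_smul, smul_comm c]
  congr 2
  ext z
  simp
  ring

theorem christoffel_zero_left (G : E → E →L[ℝ] E →L[ℝ] ℝ) (x w : E) :
    christoffel G x 0 w = 0 := by
  simpa using christoffel_smul_left G x 0 0 w

theorem christoffel_zero_right (G : E → E →L[ℝ] E →L[ℝ] ℝ) (x u : E) :
    christoffel G x u 0 = 0 := by
  simpa using christoffel_smul_right G x 0 u 0

theorem christoffel_neg_left (G : E → E →L[ℝ] E →L[ℝ] ℝ) (x u w : E) :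
    christoffel G x (-u) w = -christoffel G x u w := by
  simpa using christoffel_smul_left G x (-1) u w

theorem nabla_apply (G : E → E →L[ℝ] E →L[ℝ] ℝ) (X Y : E → E) (x : E) :
    nabla G X Y x = fderiv ℝ Y x (X x) + christoffel G x (X x) (Y x) := rfl

theorem nabla_const (G : E → E →L[ℝ] E →L[ℝ] ℝ) (X : E → E) (b x : E) :
    nabla G X (fun _ => b) x = christoffel G x (X x) b := by
  simp [nabla]

/-- The connection is tensorial in the direction, so only the value of `X` counts, while the germ of
`Y` is needed. -/
theorem nabla_congr {G : E → E →L[ℝ] E →L[ℝ] ℝ} {X X' Y Y' : E → E} {x : E}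
    (hX : X x = X' x) (hY : Y =ᶠ[𝓝 x] Y') : nabla G X Y x = nabla G X' Y' x := by
  rw [nabla_apply, nabla_apply, hX, hY.fderiv_eq, hY.eq_of_nhds]

theorem christoffel_congr {G G' : E → E →L[ℝ] E →L[ℝ] ℝ} {x : E} (h : G =ᶠ[𝓝 x] G') (u w : E) :
    christoffel G x u w = christoffel G' x u w := by
  rw [christoffel, christoffel, h.fderiv_eq, h.eq_of_nhds]

theorem nabla_congr_metric {G G' : E → E →L[ℝ] E →L[ℝ] ℝ} {x : E} (h : G =ᶠ[𝓝 x] G')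
    (X Y : E → E) : nabla G X Y x = nabla G' X Y x := by
  rw [nabla_apply, nabla_apply, christoffel_congr h]

namespace IsLocalMetric

variable {G : E → E →L[ℝ] E →L[ℝ] ℝ} {x₀ : E}

theorem eventually_differentiableAt (h : IsLocalMetric G x₀) :
    ∀ᶠ x in 𝓝 x₀, DifferentiableAt ℝ G x := by
  have := h.contDiffAt.of_le (show (1 : WithTop ℕ∞) ≤ ∞ by exact_mod_cast le_top)
  filter_upwards [this.eventually (by simp)] with x hx
  exact hx.differentiableAt (by simp)

theorem fderiv_symm (h : IsLocalMetric G x₀) {x : E} (hx : DifferentiableAt ℝ G x) (z u w : E) :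
    fderiv ℝ G x z u w = fderiv ℝ G x z w u := by
  rw [fderiv_apply_apply hx, fderiv_apply_apply hx]
  simp_rw [h.symm _ u w]

variable [FiniteDimensional ℝ E]

/-- A Levi-Civita connection is compatible with the metric. -/
theorem fderiv_inner (h : IsLocalMetric G x₀) {W : E → E} (hW : DifferentiableAt ℝ W x₀)
    (b : E) : fderiv ℝ (fun x => G x b (W x)) x₀ b =
      G x₀ (christoffel G x₀ b b) (W x₀) + G x₀ b (nabla G (fun _ => b) W x₀) := by
  have hx := h.eventually_differentiableAt.self_of_nhds
  have hp := h.pos.self_of_nhds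
  have h1 : HasFDerivAt (fun y => G y b (W y)) _ x₀ :=
    (hx.hasFDerivAt.clm_apply (hasFDerivAt_const b x₀)).clm_apply hW.hasFDerivAt
  rw [h1.fderiv, nabla_apply, map_add, christoffel_spec hp, h.symm _ b (christoffel _ _ _ _),
    christoffel_spec hp, h.fderiv_symm hx b (W x₀) b]
  simp
  ring

theorem differentiableAt_christoffel (h : IsLocalMetric G x₀) {u w : E → E}
    (hu : DifferentiableAt ℝ u x₀) (hw : DifferentiableAt ℝ w x₀) :
    DifferentiableAt ℝ (fun x => christoffel G x (u x) (w x)) x₀ := by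
  have hinv : DifferentiableAt ℝ (fun x => (G x).inverse) x₀ := by
    -- Inversion is differentiable at an invertible map, hence along `G` near `x₀`.
    have h1 : ContDiffAt ℝ 1 (ContinuousLinearMap.inverse : (E →L[ℝ] E →L[ℝ] ℝ) → _) (G x₀) :=
      (isInvertible_of_pos h.pos.self_of_nhds).contDiffAt_map_inverse
    exact (h1.differentiableAt (by simp)).comp x₀
      h.eventually_differentiableAt.self_of_nhds
  have hD : DifferentiableAt ℝ (fderiv ℝ G) x₀ :=
    (h.contDiffAt.fderiv_right (m := 1) two_le_smooth).differentiableAt (by simp)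
  have hflip : DifferentiableAt ℝ (fun x => ((fderiv ℝ G x).flip (u x)).flip (w x)) x₀ :=
    (differentiableAt_flip ((differentiableAt_flip hD).clm_apply hu)).clm_apply hw
  exact hinv.clm_apply ((((hD.clm_apply hu).clm_apply hw).add
    ((hD.clm_apply hw).clm_apply hu)).sub hflip |>.const_smul (1 / 2 : ℝ))

theorem differentiableAt_nabla (h : IsLocalMetric G x₀) {X W : E → E}
    (hX : DifferentiableAt ℝ X x₀) (hW : ContDiffAt ℝ ∞ W x₀) :
    DifferentiableAt ℝ (nabla G X W) x₀ := by
  have hW' : DifferentiableAt ℝ W x₀ := hW.differentiableAt (by simp)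
  have hD : DifferentiableAt ℝ (fderiv ℝ W) x₀ :=
    (hW.fderiv_right (m := 1) two_le_smooth).differentiableAt (by simp)
  exact (hD.clm_apply hX).add (h.differentiableAt_christoffel hX hW')

end IsLocalMetric

/-- The second covariant derivative `∇_{∇_a b} W - ∇_a ∇_b W`, where `a` and `b` are constant
vector fields. -/
def secondNabla (G : E → E →L[ℝ] E →L[ℝ] ℝ) (W : E → E) (x a b : E) : E :=
  nabla G (nabla G (fun _ => a) (fun _ => b)) W x - nabla G (fun _ => a) (nabla G (fun _ => b) W) x

/-- The second covariant derivative as a bilinear map. -/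
def secondNablaBilin [FiniteDimensional ℝ E] {G : E → E →L[ℝ] E →L[ℝ] ℝ} {x₀ : E}
    (h : IsLocalMetric G x₀)
    {W : E → E} (hW : ContDiffAt ℝ ∞ W x₀) : E →ₗ[ℝ] E →ₗ[ℝ] E :=
  LinearMap.mk₂ ℝ (secondNabla G W x₀)
    (fun a a' b => by
      simp only [secondNabla, nabla_apply G _ W, nabla_apply G _ (nabla G _ W), nabla_const,
        christoffel_add_left, map_add]
      abel)
    (fun c a b => by
      simp only [secondNabla, nabla_apply G _ W, nabla_apply G _ (nabla G _ W), nabla_const,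
        christoffel_smul_left, map_smul, smul_sub, smul_add])
    (fun a b b' => by
      -- Unlike `a`, the direction `b` sits under a derivative: linearity in it is an identity of
      -- fields, and differentiating it requires `nabla G _ W` to be differentiable.
      have hadd : nabla G (fun _ => b + b') W =
          nabla G (fun _ => b) W + nabla G (fun _ => b') W := by
        ext x
        simp only [nabla_apply, christoffel_add_left, map_add, Pi.add_apply]
        abel
      have hb := h.differentiableAt_nabla (differentiableAt_const b) hW
      have hb' := h.differentiableAt_nabla (differentiableAt_const b') hW
      rw [secondNabla, hadd, nabla_apply G _ (_ + _), fderiv_add hb hb']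
      simp only [secondNabla, nabla_apply G _ W, nabla_apply G _ (nabla G _ W), nabla_const,
        christoffel_add_left, christoffel_add_right, map_add, Pi.add_apply, add_apply]
      abel)
    (fun c a b => by
      have hadd : nabla G (fun _ => c • b) W = c • nabla G (fun _ => b) W := by
        ext x
        simp only [nabla_apply, christoffel_smul_left, map_smul, Pi.smul_apply, smul_add]
      have hb := h.differentiableAt_nabla (differentiableAt_const b) hW
      rw [secondNabla, hadd, nabla_apply G _ (c • _), fderiv_const_smul hb]
      simp only [secondNabla, nabla_apply G _ W, nabla_apply G _ (nabla G _ W), nabla_const,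
        christoffel_smul_left, christoffel_smul_right, map_smul, Pi.smul_apply, smul_apply,
        smul_sub]
      simp only [smul_add])

end Local

/-! ### Warped products of metrics on vector spaces -/

section LocalWarped

variable {E : Type*} [NormedAddCommGroup E] [NormedSpace ℝ E]
  {E' : Type*} [NormedAddCommGroup E'] [NormedSpace ℝ E']

/-- The warped product of two metrics on vector spaces. -/
def warpedLocal (GB : E → E →L[ℝ] E →L[ℝ] ℝ) (φ : E → ℝ) (GF : E' → E' →L[ℝ] E' →L[ℝ] ℝ) :
    E × E' → E × E' →L[ℝ] E × E' →L[ℝ] ℝ := fun z =>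
  (GB z.1).bilinearComp (ContinuousLinearMap.fst ℝ E E') (ContinuousLinearMap.fst ℝ E E') +
    φ z.1 ^ 2 •
      (GF z.2).bilinearComp (ContinuousLinearMap.snd ℝ E E') (ContinuousLinearMap.snd ℝ E E')

theorem warpedLocal_apply (GB : E → E →L[ℝ] E →L[ℝ] ℝ) (φ : E → ℝ)
    (GF : E' → E' →L[ℝ] E' →L[ℝ] ℝ) (z u w : E × E') :
    warpedLocal GB φ GF z u w = GB z.1 u.1 w.1 + φ z.1 ^ 2 * GF z.2 u.2 w.2 := rfl

variable {GB : E → E →L[ℝ] E →L[ℝ] ℝ} {φ : E → ℝ} {GF : E' → E' →L[ℝ] E' →L[ℝ] ℝ}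

theorem contDiffAt_bilinearComp {X Y : Type*} [NormedAddCommGroup X] [NormedSpace ℝ X]
    [NormedAddCommGroup Y] [NormedSpace ℝ Y] {A : X → E →L[ℝ] E →L[ℝ] ℝ} {x : X} {n : WithTop ℕ∞}
    (hA : ContDiffAt ℝ n A x) {L : X → Y →L[ℝ] E} (hL : ContDiffAt ℝ n L x) :
    ContDiffAt ℝ n (fun x => (A x).bilinearComp (L x) (L x)) x := by
  -- Written with flips, which are continuous linear, the pullback is built from compositions of
  -- smooth families only.
  have e : ∀ x, (A x).bilinearComp (L x) (L x) =
      ContinuousLinearMap.flipₗᵢ ℝ Y Y ℝ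
        ((ContinuousLinearMap.flipₗᵢ ℝ Y E ℝ ((A x).comp (L x))).comp (L x)) := fun _ => rfl
  simp_rw [e]
  exact (ContinuousLinearMap.flipₗᵢ ℝ Y Y ℝ).contDiff.contDiffAt.comp x
    (((ContinuousLinearMap.flipₗᵢ ℝ Y E ℝ).contDiff.contDiffAt.comp x (hA.clm_comp hL)).clm_comp hL)

theorem isLocalMetric_warpedLocal {z : E × E'} (hB : IsLocalMetric GB z.1)
    (hF : IsLocalMetric GF z.2) (hφ : ContDiffAt ℝ ∞ φ z.1) (hpos : ∀ x, 0 < φ x) :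
    IsLocalMetric (warpedLocal GB φ GF) z where
  symm x u w := by
    rw [warpedLocal_apply, warpedLocal_apply, hB.symm, hF.symm]
  pos := by
    filter_upwards [continuousAt_fst.eventually hB.pos, continuousAt_snd.eventually hF.pos]
      with x hx hy v hv
    rw [warpedLocal_apply]
    have hφ2 : 0 < φ x.1 ^ 2 := by have := hpos x.1; positivity
    have hx' : 0 ≤ GB x.1 v.1 v.1 := by
      rcases eq_or_ne v.1 0 with h | h
      · simp [h]
      · exact (hx _ h).le
    by_cases h2 : v.2 = 0
    · have h1 : v.1 ≠ 0 := fun h1 => hv (Prod.ext h1 h2)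
      simpa [h2] using hx _ h1
    · exact add_pos_of_nonneg_of_pos hx' (mul_pos hφ2 (hy _ h2))
  contDiffAt := by
    have h1 := contDiffAt_bilinearComp (hB.contDiffAt.comp z contDiffAt_fst)
      (contDiffAt_const (c := ContinuousLinearMap.fst ℝ E E'))
    have h2 := contDiffAt_bilinearComp (hF.contDiffAt.comp z contDiffAt_snd)
      (contDiffAt_const (c := ContinuousLinearMap.snd ℝ E E'))
    exact h1.add (((hφ.comp z contDiffAt_fst).pow 2).smul h2)

theorem fderiv_warpedLocal {z : E × E'} (hB : DifferentiableAt ℝ GB z.1)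
    (hF : DifferentiableAt ℝ GF z.2) (hφ : DifferentiableAt ℝ φ z.1)
    (hG : DifferentiableAt ℝ (warpedLocal GB φ GF) z) (e u w : E × E') :
    fderiv ℝ (warpedLocal GB φ GF) z e u w = fderiv ℝ GB z.1 e.1 u.1 w.1
      + 2 * φ z.1 * fderiv ℝ φ z.1 e.1 * GF z.2 u.2 w.2
      + φ z.1 ^ 2 * fderiv ℝ GF z.2 e.2 u.2 w.2 := by
  rw [fderiv_apply_apply hG, fderiv_apply_apply hB, fderiv_apply_apply hF]
  simp_rw [warpedLocal_apply]
  have h1 : HasFDerivAt (fun z : E × E' => GB z.1 u.1 w.1) _ z :=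
    (((hB.clm_apply (differentiableAt_const u.1)).clm_apply
      (differentiableAt_const w.1)).hasFDerivAt).comp z hasFDerivAt_fst
  have h2 : HasFDerivAt (fun z : E × E' => GF z.2 u.2 w.2) _ z :=
    (((hF.clm_apply (differentiableAt_const u.2)).clm_apply
      (differentiableAt_const w.2)).hasFDerivAt).comp z hasFDerivAt_snd
  have h3 : HasFDerivAt (fun z : E × E' => φ z.1) _ z := hφ.hasFDerivAt.comp z hasFDerivAt_fst
  have h4 : HasFDerivAt (fun z : E × E' => GB z.1 u.1 w.1 + φ z.1 ^ 2 * GF z.2 u.2 w.2) _ z :=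
    h1.add ((h3.pow 2).mul h2)
  rw [h4.fderiv]
  simp
  ring

/-- A pair of metrics and a warping function that are regular near a point. -/
structure IsLocalWarped (GB : E → E →L[ℝ] E →L[ℝ] ℝ) (φ : E → ℝ)
    (GF : E' → E' →L[ℝ] E' →L[ℝ] ℝ) (x₀ : E) (y₀ : E') : Prop where
  base : IsLocalMetric GB x₀
  fiber : IsLocalMetric GF y₀
  contDiffAt : ContDiffAt ℝ ∞ φ x₀
  pos : ∀ x, 0 < φ x

theorem eventually_differentiableAt_of_contDiffAt {X Y : Type*} [NormedAddCommGroup X]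
    [NormedSpace ℝ X] [NormedAddCommGroup Y] [NormedSpace ℝ Y] {u : X → Y} {x₀ : X}
    (h : ContDiffAt ℝ ∞ u x₀) : ∀ᶠ x in 𝓝 x₀, DifferentiableAt ℝ u x := by
  have := h.of_le (show (1 : WithTop ℕ∞) ≤ ∞ by exact_mod_cast le_top)
  filter_upwards [this.eventually (by simp)] with x hx
  exact hx.differentiableAt (by simp)

theorem differentiableAt_fderiv {X Y : Type*} [NormedAddCommGroup X]
    [NormedSpace ℝ X] [NormedAddCommGroup Y] [NormedSpace ℝ Y] {u : X → Y} {x₀ : X}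
    (h : ContDiffAt ℝ ∞ u x₀) : DifferentiableAt ℝ (fderiv ℝ u) x₀ :=
  (h.fderiv_right (m := 1) two_le_smooth).differentiableAt (by simp)

/-- The Hessian of `φ` with respect to the metric `G`. -/
def hessLocal (G : E → E →L[ℝ] E →L[ℝ] ℝ) (φ : E → ℝ) (x a b : E) : ℝ :=
  fderiv ℝ (fun y => fderiv ℝ φ y b) x a - fderiv ℝ φ x (christoffel G x a b)

namespace IsLocalWarped

variable {x₀ : E} {y₀ : E'} {W₁ : E → E} {W₂ : E' → E'}

theorem isLocalMetric (h : IsLocalWarped GB φ GF x₀ y₀) :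
    IsLocalMetric (warpedLocal GB φ GF) (x₀, y₀) :=
  isLocalMetric_warpedLocal h.base h.fiber h.contDiffAt h.pos

theorem contDiffAt_prod (hW₁ : ContDiffAt ℝ ∞ W₁ x₀) (hW₂ : ContDiffAt ℝ ∞ W₂ y₀) :
    ContDiffAt ℝ ∞ (fun z : E × E' => (W₁ z.1, W₂ z.2)) (x₀, y₀) :=
  (hW₁.comp (x₀, y₀) contDiffAt_fst).prodMk (hW₂.comp (x₀, y₀) contDiffAt_snd)

/-- A vertical derivative sees only the slice over `x₀`, where `φ`, its gradient and `W₁` are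
constant. -/
theorem fderiv_inr {X : Type*} [NormedAddCommGroup X] [NormedSpace ℝ X] {Z : E × E' → X}
    (hZ : DifferentiableAt ℝ Z (x₀, y₀)) (b : E') :
    fderiv ℝ Z (x₀, y₀) (0, b) = fderiv ℝ (fun y => Z (x₀, y)) y₀ b := by
  have : HasFDerivAt (fun y => Z (x₀, y)) _ y₀ :=
    hZ.hasFDerivAt.comp y₀ (hasFDerivAt_prodMk_right x₀ y₀)
  rw [this.fderiv]
  simp

end IsLocalWarped

section
variable [FiniteDimensional ℝ E] [FiniteDimensional ℝ E']

/-- The gradient of `φ` with respect to the metric `G`. -/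
def gradLocal (G : E → E →L[ℝ] E →L[ℝ] ℝ) (φ : E → ℝ) (x : E) : E :=
  (G x).inverse (fderiv ℝ φ x)

/-- The mixed terms come from differentiating `φ²` in the Koszul formula: the derivative along the
test vector yields the gradient term, those along `u` and `w` the logarithmic derivatives. -/
theorem christoffel_warpedLocal {z : E × E'} (hB : DifferentiableAt ℝ GB z.1)
    (hF : DifferentiableAt ℝ GF z.2) (hφ : DifferentiableAt ℝ φ z.1)
    (hG : DifferentiableAt ℝ (warpedLocal GB φ GF) z)
    (hBp : ∀ v, v ≠ 0 → 0 < GB z.1 v v) (hFp : ∀ v, v ≠ 0 → 0 < GF z.2 v v)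
    (hGp : ∀ v, v ≠ 0 → 0 < warpedLocal GB φ GF z v v)
    (hpos : ∀ x, 0 < φ x) (u w : E × E') :
    christoffel (warpedLocal GB φ GF) z u w =
      (christoffel GB z.1 u.1 w.1 - (φ z.1 * GF z.2 u.2 w.2) • gradLocal GB φ z.1,
       christoffel GF z.2 u.2 w.2 + (fderiv ℝ φ z.1 u.1 / φ z.1) • w.2
        + (fderiv ℝ φ z.1 w.1 / φ z.1) • u.2) := by
  apply christoffel_eq_of_spec hGp
  intro v
  have h0 := (hpos z.1).ne'
  rw [warpedLocal_apply, fderiv_warpedLocal hB hF hφ hG, fderiv_warpedLocal hB hF hφ hG,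
    fderiv_warpedLocal hB hF hφ hG]
  simp only [map_add, map_sub, map_smul, sub_apply, add_apply, smul_apply, smul_eq_mul,
    christoffel_spec hBp, christoffel_spec hFp]
  rw [gradLocal, apply_inverse_of_pos hBp]
  field_simp
  ring

namespace IsLocalWarped

variable {x₀ : E} {y₀ : E'} {W₁ : E → E} {W₂ : E' → E'}

theorem eventually_christoffel (h : IsLocalWarped GB φ GF x₀ y₀) :
    ∀ᶠ z in 𝓝 (x₀, y₀), ∀ u w, christoffel (warpedLocal GB φ GF) z u w =
      (christoffel GB z.1 u.1 w.1 - (φ z.1 * GF z.2 u.2 w.2) • gradLocal GB φ z.1,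
       christoffel GF z.2 u.2 w.2 + (fderiv ℝ φ z.1 u.1 / φ z.1) • w.2
        + (fderiv ℝ φ z.1 w.1 / φ z.1) • u.2) := by
  have c1 : ContinuousAt (Prod.fst : E × E' → E) (x₀, y₀) := continuousAt_fst
  have c2 : ContinuousAt (Prod.snd : E × E' → E') (x₀, y₀) := continuousAt_snd
  filter_upwards [c1.eventually h.base.eventually_differentiableAt, c1.eventually h.base.pos,
    c2.eventually h.fiber.eventually_differentiableAt, c2.eventually h.fiber.pos,
    c1.eventually (eventually_differentiableAt_of_contDiffAt h.contDiffAt),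
    h.isLocalMetric.eventually_differentiableAt, h.isLocalMetric.pos] with z h1 h2 h3 h4 h5 h6 h7
  exact christoffel_warpedLocal h1 h3 h5 h6 h2 h4 h7 h.pos

/-- A formula on a neighbourhood, since it will be differentiated again. The neighbourhood does not
depend on `X`, which allows `X` to be itself a covariant derivative. -/
theorem eventually_nabla (h : IsLocalWarped GB φ GF x₀ y₀) (hW₁ : ContDiffAt ℝ ∞ W₁ x₀)
    (hW₂ : ContDiffAt ℝ ∞ W₂ y₀) :
    ∀ᶠ z in 𝓝 (x₀, y₀), ∀ X, nabla (warpedLocal GB φ GF) X (fun z => (W₁ z.1, W₂ z.2)) z =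
      (nabla GB (fun _ => (X z).1) W₁ z.1 - (φ z.1 * GF z.2 (X z).2 (W₂ z.2)) • gradLocal GB φ z.1,
       nabla GF (fun _ => (X z).2) W₂ z.2 + (fderiv ℝ φ z.1 (X z).1 / φ z.1) • W₂ z.2
        + (fderiv ℝ φ z.1 (W₁ z.1) / φ z.1) • (X z).2) := by
  have c1 : ContinuousAt (Prod.fst : E × E' → E) (x₀, y₀) := continuousAt_fst
  have c2 : ContinuousAt (Prod.snd : E × E' → E') (x₀, y₀) := continuousAt_snd
  filter_upwards [h.eventually_christoffel,
    c1.eventually (eventually_differentiableAt_of_contDiffAt hW₁),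
    c2.eventually (eventually_differentiableAt_of_contDiffAt hW₂)] with z hz h1 h2 X
  have hW : HasFDerivAt (fun z : E × E' => (W₁ z.1, W₂ z.2)) _ z :=
    (h1.hasFDerivAt.comp z hasFDerivAt_fst).prodMk (h2.hasFDerivAt.comp z hasFDerivAt_snd)
  rw [nabla_apply, hz, hW.fderiv]
  ext
  · simp [nabla_apply, add_sub_assoc]
  · simp [nabla_apply, add_assoc]

/-- Along `a` the fibre part is multiplied by `φ'/φ`. Applying this twice gives `(φ'/φ)' + (φ'/φ)² =
φ''/φ`, and the term along `∇_a a` completes `φ''` to the Hessian, up to sign. -/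
theorem secondNabla_base (h : IsLocalWarped GB φ GF x₀ y₀) (hW₁ : ContDiffAt ℝ ∞ W₁ x₀)
    (hW₂ : ContDiffAt ℝ ∞ W₂ y₀) (a : E) :
    secondNabla (warpedLocal GB φ GF) (fun z => (W₁ z.1, W₂ z.2)) (x₀, y₀) (a, 0) (a, 0) =
      (secondNabla GB W₁ x₀ a a, -(hessLocal GB φ x₀ a a / φ x₀) • W₂ y₀) := by
  have hn := h.eventually_nabla hW₁ hW₂
  have hc := h.eventually_christoffel.self_of_nhds
  have h0 := (h.pos x₀).ne'
  have hZ : nabla (warpedLocal GB φ GF) (fun _ => (a, 0)) (fun z => (W₁ z.1, W₂ z.2))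
      =ᶠ[𝓝 (x₀, y₀)] fun z => (nabla GB (fun _ => a) W₁ z.1,
        (fderiv ℝ φ z.1 a / φ z.1) • W₂ z.2) := by
    filter_upwards [hn] with z hz
    rw [hz]
    ext <;> simp [nabla_apply, christoffel]
  have d1 : HasFDerivAt (fun z : E × E' => nabla GB (fun _ => a) W₁ z.1) _ (x₀, y₀) :=
    HasFDerivAt.comp (x₀, y₀) (g := nabla GB (fun _ => a) W₁) (f := Prod.fst)
      (h.base.differentiableAt_nabla (differentiableAt_const a) hW₁).hasFDerivAt hasFDerivAt_fst
  have d2 : DifferentiableAt ℝ φ x₀ := h.contDiffAt.differentiableAt (by simp)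
  have d3 : DifferentiableAt ℝ (fun x => fderiv ℝ φ x a) x₀ :=
    (differentiableAt_fderiv h.contDiffAt).clm_apply (differentiableAt_const a)
  have d4 : HasFDerivAt (fun z : E × E' => fderiv ℝ φ z.1 a / φ z.1) _ (x₀, y₀) :=
    HasFDerivAt.comp (x₀, y₀) (g := fun x => fderiv ℝ φ x a / φ x)
      (d3.hasFDerivAt.mul ((hasDerivAt_inv h0).comp_hasFDerivAt x₀ d2.hasFDerivAt)) hasFDerivAt_fst
  have d5 : HasFDerivAt (fun z : E × E' => W₂ z.2) _ (x₀, y₀) :=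
    (hW₂.differentiableAt (by simp)).hasFDerivAt.comp (x₀, y₀) hasFDerivAt_snd
  have dZ : HasFDerivAt (fun z : E × E' => (nabla GB (fun _ => a) W₁ z.1,
        (fderiv ℝ φ z.1 a / φ z.1) • W₂ z.2)) _ (x₀, y₀) := d1.prodMk (d4.smul d5)
  rw [secondNabla, hn.self_of_nhds, nabla_const, hc, nabla_congr rfl hZ,
    nabla_apply (warpedLocal GB φ GF), hc,
    dZ.fderiv]
  ext
  · simp [secondNabla, nabla_apply, christoffel_zero_right]
  · simp [nabla_apply, hessLocal, christoffel_zero_left, christoffel_zero_right]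
    match_scalars
    field_simp
    ring

/-- In the base component, `GF(b, ∇_b W₂)` arises twice: from differentiating `GF(b, W₂)` by metric
compatibility, and from the Christoffel term of the second derivative. Hence the factor 2. The
leftover `GF(∇_b b, W₂)` cancels against the term along `∇_b b`. -/
theorem secondNabla_fiber (h : IsLocalWarped GB φ GF x₀ y₀) (hW₁ : ContDiffAt ℝ ∞ W₁ x₀)
    (hW₂ : ContDiffAt ℝ ∞ W₂ y₀) (b : E') :
    secondNabla (warpedLocal GB φ GF) (fun z => (W₁ z.1, W₂ z.2)) (x₀, y₀) (0, b) (0, b) =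
      (-(φ x₀ * GF y₀ b b) • nabla GB (fun _ => gradLocal GB φ x₀) W₁ x₀
        + (2 * φ x₀ * GF y₀ b (nabla GF (fun _ => b) W₂ y₀)) • gradLocal GB φ x₀
        + (GF y₀ b b * fderiv ℝ φ x₀ (W₁ x₀)) • gradLocal GB φ x₀,
       secondNabla GF W₂ y₀ b b
        - (GF y₀ b b * fderiv ℝ φ x₀ (gradLocal GB φ x₀)) • W₂ y₀
        + (GF y₀ b (W₂ y₀) * fderiv ℝ φ x₀ (gradLocal GB φ x₀)) • b) := by
  have hn := h.eventually_nabla hW₁ hW₂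
  have hc := h.eventually_christoffel.self_of_nhds
  have h0 := (h.pos x₀).ne'
  set Z := nabla (warpedLocal GB φ GF) (fun _ => (0, b)) (fun z => (W₁ z.1, W₂ z.2)) with hZdef
  have hZd : DifferentiableAt ℝ Z (x₀, y₀) := h.isLocalMetric.differentiableAt_nabla
    (differentiableAt_const _) (contDiffAt_prod hW₁ hW₂)
  have hZ : (fun y => Z (x₀, y)) =ᶠ[𝓝 y₀] fun y => (-((φ x₀ * GF y b (W₂ y)) • gradLocal GB φ x₀),
        nabla GF (fun _ => b) W₂ y + (fderiv ℝ φ x₀ (W₁ x₀) / φ x₀) • b) := by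
    have c : ContinuousAt (fun y : E' => (x₀, y)) y₀ := by fun_prop
    filter_upwards [c.eventually hn] with y hy
    rw [hZdef, hy]
    ext <;> simp [nabla_apply, christoffel]
  have dn := h.fiber.differentiableAt_nabla (differentiableAt_const b) hW₂
  have dW₂ : DifferentiableAt ℝ W₂ y₀ := hW₂.differentiableAt (by simp)
  have dF : DifferentiableAt ℝ (fun y => GF y b (W₂ y)) y₀ :=
    ((h.fiber.contDiffAt.differentiableAt (by simp)).clm_apply (differentiableAt_const b)).clm_apply
      dW₂
  have dZ : HasFDerivAt (fun y => (-((φ x₀ * GF y b (W₂ y)) • gradLocal GB φ x₀),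
        nabla GF (fun _ => b) W₂ y + (fderiv ℝ φ x₀ (W₁ x₀) / φ x₀) • b)) _ y₀ :=
    ((dF.hasFDerivAt.const_mul (φ x₀)).smul_const (gradLocal GB φ x₀)).neg.prodMk
      (dn.hasFDerivAt.add_const ((fderiv ℝ φ x₀ (W₁ x₀) / φ x₀) • b))
  have hZ0 : Z (x₀, y₀) = (-((φ x₀ * GF y₀ b (W₂ y₀)) • gradLocal GB φ x₀),
        nabla GF (fun _ => b) W₂ y₀ + (fderiv ℝ φ x₀ (W₁ x₀) / φ x₀) • b) := hZ.eq_of_nhds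
  rw [secondNabla, ← hZdef, hn.self_of_nhds, nabla_const, hc, nabla_apply _ _ Z, hc, hZ0,
    fderiv_inr hZd, hZ.fderiv_eq, dZ.fderiv]
  ext
  · simp [nabla_apply, h.fiber.fderiv_inner dW₂, christoffel_zero_left, christoffel_neg_left,
      christoffel_smul_left]
    match_scalars <;> field_simp
    ring
  · simp [secondNabla, nabla_apply, christoffel_zero_left, christoffel_add_right,
      christoffel_smul_right]
    match_scalars <;> field_simp
    ring

/-- The rough Laplacian of `W₁ + W₂` with respect to a warped product metric. -/
theorem sum_secondNabla (h : IsLocalWarped GB φ GF x₀ y₀) (hW₁ : ContDiffAt ℝ ∞ W₁ x₀)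
    (hW₂ : ContDiffAt ℝ ∞ W₂ y₀) {ι κ κ' : Type*} [Fintype ι] [Fintype κ] [Fintype κ']
    [DecidableEq ι] [DecidableEq κ] [DecidableEq κ'] (b : Module.Basis ι ℝ (E × E'))
    (c : Module.Basis κ ℝ E) (d : Module.Basis κ' ℝ E')
    (hb : ∀ i j, warpedLocal GB φ GF (x₀, y₀) (b i) (b j) = if i = j then 1 else 0)
    (hc : ∀ i j, GB x₀ (c i) (c j) = if i = j then 1 else 0)
    (hd : ∀ i j, GF y₀ (d i) (d j) = if i = j then 1 else 0) :
    ∑ i, secondNabla (warpedLocal GB φ GF) (fun z => (W₁ z.1, W₂ z.2)) (x₀, y₀) (b i) (b i) =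
      (∑ i, secondNabla GB W₁ x₀ (c i) (c i)
        - ((Fintype.card κ' : ℝ) / φ x₀) • nabla GB (fun _ => gradLocal GB φ x₀) W₁ x₀
        + (2 / φ x₀ * ∑ j, GF y₀ (d j) (nabla GF (fun _ => d j) W₂ y₀)) • gradLocal GB φ x₀
        + ((Fintype.card κ' : ℝ) * (fderiv ℝ φ x₀ (W₁ x₀) / φ x₀ ^ 2)) • gradLocal GB φ x₀,
       (1 / φ x₀ ^ 2) • ∑ j, secondNabla GF W₂ y₀ (d j) (d j)
        + ((-∑ i, hessLocal GB φ x₀ (c i) (c i)) / φ x₀) • W₂ y₀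
        + ((1 - (Fintype.card κ' : ℝ)) * (fderiv ℝ φ x₀ (gradLocal GB φ x₀) / φ x₀ ^ 2)) •
          W₂ y₀) := by
  have h0 := (h.pos x₀).ne'
  have hG := h.isLocalMetric
  -- The fibre metric is scaled by `φ²`, so vertical unit vectors are shortened by `φ⁻¹`.
  let d' := d.isUnitSMul (fun _ => (IsUnit.mk0 _ (inv_ne_zero h0) : IsUnit (φ x₀)⁻¹))
  have hd' : ∀ j, d' j = (φ x₀)⁻¹ • d j := fun j => d.isUnitSMul_apply _ _
  let β : E × E' →ₗ[ℝ] E × E' →ₗ[ℝ] ℝ := LinearMap.mk₂ ℝ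
    (fun v w => warpedLocal GB φ GF (x₀, y₀) v w) (fun _ _ _ => by simp) (fun _ _ _ => by simp)
      (fun _ _ _ => by simp) (fun _ _ _ => by simp)
  let T := secondNablaBilin hG (contDiffAt_prod hW₁ hW₂)
  have hcd : ∀ i j, β (c.prod d' i) (c.prod d' j) = if i = j then 1 else 0 := by
    rintro (i | i) (j | j)
    · simp [β, warpedLocal_apply, hc]
    · simp [β, warpedLocal_apply]
    · simp [β, warpedLocal_apply]
    · rcases eq_or_ne i j with rfl | hij
      · simp [β, warpedLocal_apply, hd', hd]
        field_simp
      · simp [β, warpedLocal_apply, hd', hd, hij]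
  have key : ∑ i, T (b i) (b i) = ∑ j, T (c.prod d' j) (c.prod d' j) :=
    sum_bilin_orthonormal_eq β (hG.symm _) b (c.prod d') hb hcd T
  have hW₂' : ∑ j, GF y₀ (d j) (W₂ y₀) • d j = W₂ y₀ := by
    let γ : E' →ₗ[ℝ] E' →ₗ[ℝ] ℝ := LinearMap.mk₂ ℝ
      (fun v w => GF y₀ v w) (fun _ _ _ => by simp) (fun _ _ _ => by simp)
        (fun _ _ _ => by simp) (fun _ _ _ => by simp)
    conv_rhs => rw [← d.sum_repr (W₂ y₀)]
    exact Finset.sum_congr rfl fun j _ => by rw [repr_eq_of_orthonormal γ d hd]; rfl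
  have hbase : ∀ i, T (c.prod d' (Sum.inl i)) (c.prod d' (Sum.inl i)) =
      (secondNabla GB W₁ x₀ (c i) (c i), -(hessLocal GB φ x₀ (c i) (c i) / φ x₀) • W₂ y₀) := by
    intro i
    rw [← h.secondNabla_base hW₁ hW₂]
    simp [T, secondNablaBilin]
  have hfib : ∀ j, T (c.prod d' (Sum.inr j)) (c.prod d' (Sum.inr j)) =
      (φ x₀ ^ 2)⁻¹ • secondNabla (warpedLocal GB φ GF) (fun z => (W₁ z.1, W₂ z.2)) (x₀, y₀)
        (0, d j) (0, d j) := by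
    intro j
    have e : c.prod d' (Sum.inr j) = (φ x₀)⁻¹ • ((0, d j) : E × E') := by
      simp [hd']
    rw [e, map_smul, map_smul, LinearMap.smul_apply, smul_smul]
    congr 1
    field_simp
  have hhess : ∑ i, -(hessLocal GB φ x₀ (c i) (c i) / φ x₀) • W₂ y₀ =
      ((-∑ i, hessLocal GB φ x₀ (c i) (c i)) / φ x₀) • W₂ y₀ := by
    rw [← Finset.sum_smul, Finset.sum_neg_distrib, ← Finset.sum_div, neg_div]
  -- The expansion of `W₂` in the basis `d` supplies the `1` in the coefficient `1 - n`; the `-n` is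
  -- the trace of `GF`.
  have hgrad : ∑ j, (GF y₀ (d j) (W₂ y₀) * fderiv ℝ φ x₀ (gradLocal GB φ x₀)) • d j =
      fderiv ℝ φ x₀ (gradLocal GB φ x₀) • W₂ y₀ := by
    conv_rhs => rw [← hW₂', Finset.smul_sum]
    exact Finset.sum_congr rfl fun j _ => by rw [smul_smul, mul_comm]
  calc _ = ∑ j, T (c.prod d' j) (c.prod d' j) := key
    _ = _ := by
      rw [Fintype.sum_sum_type]
      simp only [hbase, hfib, h.secondNabla_fiber hW₁ hW₂, hd, if_true]
      rw [← Finset.smul_sum]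
      ext
      · simp only [Prod.fst_add, Prod.smul_fst, Prod.fst_sum, Finset.sum_add_distrib,
          ← Finset.sum_smul, ← Finset.mul_sum, Finset.sum_const, Finset.card_univ, nsmul_eq_mul]
        match_scalars <;> field_simp
      · simp only [Prod.snd_add, Prod.smul_snd, Prod.snd_sum, Finset.sum_add_distrib,
          Finset.sum_sub_distrib, Finset.sum_const, Finset.card_univ, hhess, hgrad]
        match_scalars <;> field_simp
        ring

end IsLocalWarped

end

end LocalWarped

/-! ### Vector fields and metrics in a chart -/

section Chart

variable {E : Type*} [NormedAddCommGroup E] [NormedSpace ℝ E]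
  {H : Type*} [TopologicalSpace H] {I : ModelWithCorners ℝ E H}
  {M : Type*} [TopologicalSpace M] [ChartedSpace H M] [IsManifold I ∞ M]

theorem isManifold_one_of_smooth (I : ModelWithCorners ℝ E H) (M : Type*) [TopologicalSpace M]
    [ChartedSpace H M] [IsManifold I ∞ M] : IsManifold I 1 M :=
  IsManifold.of_le (n := ∞) (by exact_mod_cast le_top)

/-- A tangent space is the model space read in the preferred chart at its point, so that chart has
identity derivative at its centre. -/
theorem toChart_eq (p : M) (v : TangentSpace I p) : toChart p v = v := by
  have := isManifold_one_of_smooth I M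
  rw [toChart, mfderiv_extChartAt_self]
  rfl

theorem chartMetric_apply (g : Metric I M) (p : M) (x u w : E) :
    chartMetric g p x u w = g.inner ((extChartAt I p).symm x) (chartSymmDeriv I p x u)
      (chartSymmDeriv I p x w) := rfl

variable [I.Boundaryless]

theorem chartSymmDeriv_self (p : M) :
    chartSymmDeriv I p (extChartAt I p p) = ContinuousLinearMap.id ℝ E := by
  have := isManifold_one_of_smooth I M
  have h := mfderivWithin_range_extChartAt_symm (I := I) (x := p)
  rw [I.range_eq_univ, mfderivWithin_univ] at h
  exact h

theorem fromChart_eq (p : M) (w : E) : fromChart (I := I) p w = w :=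
  congrArg (fun L : E →L[ℝ] E => L w) (chartSymmDeriv_self (I := I) p)

theorem chartMetric_self (g : Metric I M) (p : M) :
    chartMetric g p (extChartAt I p p) = g.inner p := by
  ext u w
  rw [chartMetric_apply, chartSymmDeriv_self, extChartAt_to_inv]
  rfl

/-- The derivative of the chart at `p`, at the point with coordinates `x`. -/
def chartDeriv (I : ModelWithCorners ℝ E H) (p : M) (x : E) : E →L[ℝ] E :=
  mfderiv I 𝓘(ℝ, E) (extChartAt I p) ((extChartAt I p).symm x)

theorem chartDeriv_chartSymmDeriv (p : M) {x : E} (hx : x ∈ (extChartAt I p).target) (v : E) :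
    chartDeriv I p x (chartSymmDeriv I p x v) = v := by
  have := isManifold_one_of_smooth I M
  have h := mfderiv_extChartAt_comp_mfderivWithin_extChartAt_symm (I := I) hx
  rw [I.range_eq_univ, mfderivWithin_univ] at h
  exact congrArg (fun L : E →L[ℝ] E => L v) h

theorem chartSymmDeriv_injective (p : M) {x : E} (hx : x ∈ (extChartAt I p).target) :
    Function.Injective (chartSymmDeriv I p x) := by
  intro v w hvw
  rw [← chartDeriv_chartSymmDeriv p hx v, ← chartDeriv_chartSymmDeriv p hx w, hvw]

/-- The coordinate expression of a smooth vector field is smooth. -/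
theorem contDiffAt_chartField {V : ∀ q : M, TangentSpace I q} (hV : SmoothVectorField V) (p : M) :
    ContDiffAt ℝ ∞ (chartField p V) (extChartAt I p p) := by
  have := isManifold_one_of_smooth I M
  have h1 := (Bundle.contMDiffAt_section p).1 (hV p)
  have h2 : ContMDiffAt 𝓘(ℝ, E) I ∞ (extChartAt I p).symm (extChartAt I p p) :=
    (contMDiffOn_extChartAt_symm p).contMDiffAt (extChartAt_target_mem_nhds p)
  have h3 := h1.comp_of_eq h2 (extChartAt_to_inv p)
  rw [contMDiffAt_iff_contDiffAt] at h3
  refine h3.congr_of_eventuallyEq ?_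
  filter_upwards [extChartAt_target_mem_nhds (I := I) p] with x hx
  have hs : (extChartAt I p).symm x ∈ (chartAt H p).source := by
    simpa using (extChartAt I p).map_target hx
  -- On the chart source, the tangent trivialization at `p` is the derivative of the chart;
  -- smoothness of a section is stated through the former.
  rw [chartField, ← TangentBundle.continuousLinearMapAt_trivializationAt hs]
  have hb : (extChartAt I p).symm x ∈ (trivializationAt E (TangentSpace I) p).baseSet := by
    simpa using hs
  exact congrFun (Bundle.Trivialization.coe_linearMapAt_of_mem (R := ℝ)
    (trivializationAt E (TangentSpace I : M → Type _) p) hb) _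

/-- Symmetry pulls back everywhere. Positivity needs the inverse chart to have injective derivative,
so it is claimed only near the centre. -/
theorem isLocalMetric_chartMetric (g : Metric I M) (p : M) :
    IsLocalMetric (chartMetric g p) (extChartAt I p p) where
  symm x u w := by
    rw [chartMetric_apply, chartMetric_apply]
    exact g.symm _ _ _
  pos := by
    filter_upwards [extChartAt_target_mem_nhds (I := I) p] with x hx v hv
    rw [chartMetric_apply]
    refine g.pos _ _ fun h => hv (chartSymmDeriv_injective p hx ?_)
    rw [map_zero]
    exact h
  contDiffAt := by
    have := isManifold_one_of_smooth I M
    have h1 := g.contMDiff p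
    rw [contMDiffAt_hom_bundle] at h1
    have h1 := h1.2
    have h2 : ContMDiffAt 𝓘(ℝ, E) I ∞ (extChartAt I p).symm (extChartAt I p p) :=
      (contMDiffOn_extChartAt_symm p).contMDiffAt (extChartAt_target_mem_nhds p)
    have h3 := h1.comp_of_eq h2 (extChartAt_to_inv p)
    rw [contMDiffAt_iff_contDiffAt] at h3
    refine h3.congr_of_eventuallyEq ?_
    filter_upwards [extChartAt_target_mem_nhds (I := I) p] with x hx
    have hs : (extChartAt I p).symm x ∈ (chartAt H p).source := by
      simpa using (extChartAt I p).map_target hx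
    -- The inverse trivialization is the derivative of the inverse chart, which identifies
    -- `chartMetric` with the bundle coordinates of `g`.
    have hL := TangentBundle.symmL_trivializationAt (I := I) (𝕜 := ℝ) hs
    rw [(extChartAt I p).right_inv hx, I.range_eq_univ, mfderivWithin_univ] at hL
    ext u w
    rw [chartMetric_apply]
    have key := inCoordinates_apply_eq₂ (𝕜 := ℝ) (F₁ := E) (F₂ := E) (F₃ := ℝ)
      (E₁ := (TangentSpace I : M → Type _)) (E₂ := (TangentSpace I : M → Type _))
      (E₃ := Bundle.Trivial M ℝ) (x₀ := p) (x := (extChartAt I p).symm x)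
      (ϕ := g.inner ((extChartAt I p).symm x)) (v := u) (w := w) (by simpa using hs)
      (by simpa using hs) (Set.mem_univ _)
    refine Eq.trans ?_ key.symm
    have hb : (extChartAt I p).symm x ∈ (trivializationAt E (TangentSpace I) p).baseSet := by
      simpa using hs
    rw [← Bundle.Trivialization.symmL_apply (R := ℝ) _ hb u,
      ← Bundle.Trivialization.symmL_apply (R := ℝ) _ hb w, hL]
    simp
    rfl

end Chart

/-! ### Product charts -/

section Product

variable {E : Type*} [NormedAddCommGroup E] [NormedSpace ℝ E]
  {H : Type*} [TopologicalSpace H] {I : ModelWithCorners ℝ E H}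
  {B : Type*} [TopologicalSpace B] [ChartedSpace H B] [IsManifold I ∞ B]
  {E' : Type*} [NormedAddCommGroup E'] [NormedSpace ℝ E']
  {H' : Type*} [TopologicalSpace H'] {J : ModelWithCorners ℝ E' H'}
  {F : Type*} [TopologicalSpace F] [ChartedSpace H' F] [IsManifold J ∞ F]

theorem chartDeriv_prod (p : B) (q : F) {x : E} {y : E'} (hx : x ∈ (extChartAt I p).target)
    (hy : y ∈ (extChartAt J q).target) :
    chartDeriv (I.prod J) (p, q) (x, y) = (chartDeriv I p x).prodMap (chartDeriv J q y) := by
  have := isManifold_one_of_smooth I B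
  have := isManifold_one_of_smooth J F
  have hx' : (extChartAt I p).symm x ∈ (chartAt H p).source := by
    simpa using (extChartAt I p).map_target hx
  have hy' : (extChartAt J q).symm y ∈ (chartAt H' q).source := by
    simpa using (extChartAt J q).map_target hy
  have h := mfderiv_prodMap (p := ((extChartAt I p).symm x, (extChartAt J q).symm y))
    (mdifferentiableAt_extChartAt (I := I) hx') (mdifferentiableAt_extChartAt (I := J) hy')
  -- Passes from the product of the two model manifolds to the vector space `E × E'` as its own
  -- model.
  rw [← modelWithCornersSelf_prod, chartedSpaceSelf_prod] at h
  rw [chartDeriv, extChartAt_prod]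
  exact h

variable [I.Boundaryless] [J.Boundaryless]

theorem chartSymmDeriv_prod (p : B) (q : F) {x : E} {y : E'} (hx : x ∈ (extChartAt I p).target)
    (hy : y ∈ (extChartAt J q).target) :
    chartSymmDeriv (I.prod J) (p, q) (x, y) =
      (chartSymmDeriv I p x).prodMap (chartSymmDeriv J q y) := by
  have := isManifold_one_of_smooth I B
  have := isManifold_one_of_smooth J F
  have h1 := mdifferentiableWithinAt_extChartAt_symm (I := I) hx
  have h2 := mdifferentiableWithinAt_extChartAt_symm (I := J) hy
  rw [I.range_eq_univ, mdifferentiableWithinAt_univ] at h1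
  rw [J.range_eq_univ, mdifferentiableWithinAt_univ] at h2
  have h := mfderiv_prodMap (p := (x, y)) h1 h2
  rw [← modelWithCornersSelf_prod, chartedSpaceSelf_prod] at h
  rw [chartSymmDeriv, extChartAt_prod]
  exact h

theorem eventually_mem_target_prod {B F : Type*} [TopologicalSpace B] [ChartedSpace H B]
    [TopologicalSpace F] [ChartedSpace H' F] (p : B) (q : F) :
    ∀ᶠ z in 𝓝 (extChartAt I p p, extChartAt J q q),
      z.1 ∈ (extChartAt I p).target ∧ z.2 ∈ (extChartAt J q).target :=
  prod_mem_nhds (extChartAt_target_mem_nhds (I := I) p) (extChartAt_target_mem_nhds (I := J) q)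

/-- The coordinate expression of `V₁ + V₂` in a product chart. -/
theorem chartField_prod (V₁ : ∀ p : B, TangentSpace I p) (V₂ : ∀ q : F, TangentSpace J q)
    (p : B) (q : F) :
    chartField (p, q) (fun z : B × F => horizontalLift V₁ z + verticalLift V₂ z)
      =ᶠ[𝓝 (extChartAt I p p, extChartAt J q q)]
        fun z => (chartField p V₁ z.1, chartField q V₂ z.2) := by
  filter_upwards [eventually_mem_target_prod (I := I) (J := J) p q] with z hz
  have h := chartDeriv_prod p q hz.1 hz.2
  have hs : (extChartAt (I.prod J) (p, q)).symm z =
    ((extChartAt I p).symm z.1, (extChartAt J q).symm z.2) := by rw [extChartAt_prod]; rfl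
  have hV : (horizontalLift V₁ ((extChartAt (I.prod J) (p, q)).symm z) +
      verticalLift V₂ ((extChartAt (I.prod J) (p, q)).symm z) : E × E') =
        (V₁ ((extChartAt I p).symm z.1), V₂ ((extChartAt J q).symm z.2)) := by
    rw [hs]
    exact Prod.ext (add_zero _) (zero_add _)
  refine (congrArg (fun L : E × E' →L[ℝ] E × E' => L _) h).trans ?_
  refine (congrArg _ hV).trans ?_
  rfl

variable [FiniteDimensional ℝ E] [FiniteDimensional ℝ E']

/-- The coordinate expression of a warped product metric in a product chart. -/
theorem chartMetric_warpedMetric (gB : Metric I B) (gF : Metric J F) (f : B → ℝ)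
    (hf : ContMDiff I 𝓘(ℝ, ℝ) ∞ f) (hpos : ∀ x, 0 < f x) (p : B) (q : F) :
    chartMetric (warpedMetric gB gF f hf hpos) (p, q)
      =ᶠ[𝓝 (extChartAt I p p, extChartAt J q q)]
        warpedLocal (chartMetric gB p) (f ∘ (extChartAt I p).symm) (chartMetric gF q) := by
  filter_upwards [eventually_mem_target_prod (I := I) (J := J) p q] with z hz
  have h := chartSymmDeriv_prod p q hz.1 hz.2
  have hs : (extChartAt (I.prod J) (p, q)).symm z =
    ((extChartAt I p).symm z.1, (extChartAt J q).symm z.2) := by rw [extChartAt_prod]; rfl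
  refine ContinuousLinearMap.ext fun u => ContinuousLinearMap.ext fun w => ?_
  rw [chartMetric_apply, warpedLocal_apply, chartMetric_apply, chartMetric_apply, h, hs]
  exact warpedInner_apply gB gF f _ _ _

end Product

/-! ### The differential operators in coordinates at the centre of a chart -/

section ChartFormulas

variable {E : Type*} [NormedAddCommGroup E] [NormedSpace ℝ E]
  {H : Type*} [TopologicalSpace H] {I : ModelWithCorners ℝ E H}
  {M : Type*} [TopologicalSpace M] [ChartedSpace H M] [IsManifold I ∞ M]

theorem hessian_eq (g : Metric I M) (f : M → ℝ) (p : M) (u w : TangentSpace I p) :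
    hessian g f p u w =
      hessLocal (chartMetric g p) (f ∘ (extChartAt I p).symm) (extChartAt I p p) u w := by
  have h := nabla_const (chartMetric g p) (fun _ => (u : E)) (w : E) (extChartAt I p p)
  simp only [hessian, toChart_eq]
  exact congrArg (fun v : E => fderiv ℝ (fun y => fderiv ℝ (f ∘ (extChartAt I p).symm) y (w : E))
    (extChartAt I p p) (u : E) -
      fderiv ℝ (f ∘ (extChartAt I p).symm) (extChartAt I p p) v) h

theorem chartField_self (V : ∀ q : M, TangentSpace I q) (p : M) :
    chartField p V (extChartAt I p p) = V p := by
  have h := toChart_eq p (V p)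
  rw [chartField, extChartAt_to_inv]
  exact h

/-- The orthonormal basis of `T_p M`, as a basis of the model space. -/
def modelBasis [FiniteDimensional ℝ E] (g : Metric I M) (p : M) :
    Module.Basis (Fin (Module.finrank ℝ E)) ℝ E :=
  orthonormalBasisAt g p

theorem laplacian_eq [FiniteDimensional ℝ E] (g : Metric I M) (f : M → ℝ) (p : M) :
    laplacian g f p = -∑ i, hessLocal (chartMetric g p) (f ∘ (extChartAt I p).symm)
      (extChartAt I p p) (modelBasis g p i) (modelBasis g p i) := by
  simp only [laplacian, hessian_eq]
  rfl

variable [I.Boundaryless]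

theorem covDeriv_eq (g : Metric I M) (V : ∀ q : M, TangentSpace I q) (p : M)
    (v : TangentSpace I p) :
    covDeriv g V p v =
      nabla (chartMetric g p) (fun _ => v) (chartField p V) (extChartAt I p p) := by
  rw [covDeriv, fromChart_eq, toChart_eq]

theorem contDiffAt_comp_chart {f : M → ℝ} (hf : ContMDiff I 𝓘(ℝ, ℝ) ∞ f) (p : M) :
    ContDiffAt ℝ ∞ (f ∘ (extChartAt I p).symm) (extChartAt I p p) := by
  rw [← contMDiffAt_iff_contDiffAt]
  exact hf.contMDiffAt.comp _
    ((contMDiffOn_extChartAt_symm p).contMDiffAt (extChartAt_target_mem_nhds p))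

theorem mfderiv_eq_fderiv_chart {M : Type*} [TopologicalSpace M] [ChartedSpace H M]
    {f : M → ℝ} (hf : ContMDiff I 𝓘(ℝ, ℝ) ∞ f) (p : M) :
    mfderiv I 𝓘(ℝ, ℝ) f p = fderiv ℝ (f ∘ (extChartAt I p).symm) (extChartAt I p p) := by
  have h : MDifferentiableAt I 𝓘(ℝ, ℝ) f p := hf.mdifferentiableAt (by simp)
  rw [h.mfderiv, I.range_eq_univ, fderivWithin_univ]
  rfl

theorem gradient_eq (g : Metric I M) {f : M → ℝ} (hf : ContMDiff I 𝓘(ℝ, ℝ) ∞ f) (p : M) :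
    gradient g f p =
      gradLocal (chartMetric g p) (f ∘ (extChartAt I p).symm) (extChartAt I p p) := by
  rw [gradLocal, chartMetric_self, ← mfderiv_eq_fderiv_chart hf]
  rfl

theorem dirDeriv_eq {M : Type*} [TopologicalSpace M] [ChartedSpace H M]
    {f : M → ℝ} (hf : ContMDiff I 𝓘(ℝ, ℝ) ∞ f) (p : M) (v : TangentSpace I p) :
    dirDeriv f p v = fderiv ℝ (f ∘ (extChartAt I p).symm) (extChartAt I p p) v := by
  rw [dirDeriv, mfderiv_eq_fderiv_chart hf]
  rfl

variable [FiniteDimensional ℝ E]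

theorem modelBasis_inner (g : Metric I M) (p : M) (i j : Fin (Module.finrank ℝ E)) :
    chartMetric g p (extChartAt I p p) (modelBasis g p i) (modelBasis g p j) =
      if i = j then 1 else 0 := by
  rw [chartMetric_self]
  exact orthonormalBasisAt_inner g p i j

theorem roughLaplacian_eq (g : Metric I M) (V : ∀ q : M, TangentSpace I q) (p : M) :
    roughLaplacian g V p = ∑ i, secondNabla (chartMetric g p) (chartField p V) (extChartAt I p p)
      (modelBasis g p i) (modelBasis g p i) := by
  rw [roughLaplacian]
  simp only [fromChart_eq, toChart_eq, Pi.sub_apply]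
  rfl

theorem divergence_eq (g : Metric I M) (V : ∀ q : M, TangentSpace I q) (p : M) :
    divergence g V p = ∑ i, chartMetric g p (extChartAt I p p) (modelBasis g p i)
      (nabla (chartMetric g p) (fun _ => modelBasis g p i) (chartField p V)
        (extChartAt I p p)) := by
  simp only [divergence, covDeriv_eq, chartMetric_self]
  rfl

end ChartFormulas

/-- Metric and field agree with their product forms only near the centre; this suffices because the
second covariant derivative depends on germs. -/
theorem secondNabla_congr {E : Type*} [NormedAddCommGroup E] [NormedSpace ℝ E]
    {G G' : E → E →L[ℝ] E →L[ℝ] ℝ} {W W' : E → E} {x : E} (hG : G =ᶠ[𝓝 x] G')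
    (hW : W =ᶠ[𝓝 x] W') (a b : E) : secondNabla G W x a b = secondNabla G' W' x a b := by
  have h : nabla G (fun _ => b) W =ᶠ[𝓝 x] nabla G' (fun _ => b) W' := by
    filter_upwards [hG.eventuallyEq_nhds, hW.eventuallyEq_nhds] with y h1 h2
    rw [nabla_congr_metric h1, nabla_congr rfl h2]
  rw [secondNabla, secondNabla, nabla_congr_metric hG, nabla_congr_metric hG,
    nabla_congr (nabla_congr_metric hG _ _) hW, nabla_congr rfl h]

/-! ### The rough Laplacian on the warped product manifold -/

section Warped

variable {E : Type*} [NormedAddCommGroup E] [NormedSpace ℝ E]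
  {H : Type*} [TopologicalSpace H] {I : ModelWithCorners ℝ E H}
  {B : Type*} [TopologicalSpace B] [ChartedSpace H B] [IsManifold I ∞ B]
  {E' : Type*} [NormedAddCommGroup E'] [NormedSpace ℝ E']
  {H' : Type*} [TopologicalSpace H'] {J : ModelWithCorners ℝ E' H'}
  {F : Type*} [TopologicalSpace F] [ChartedSpace H' F] [IsManifold J ∞ F]

theorem smoothVectorField_lift_add_lift {V₁ : ∀ p : B, TangentSpace I p}
    (hV₁ : SmoothVectorField V₁) {V₂ : ∀ q : F, TangentSpace J q} (hV₂ : SmoothVectorField V₂) :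
    SmoothVectorField (fun z : B × F => horizontalLift V₁ z + verticalLift V₂ z) := by
  have h1 : ContMDiff (I.prod J) I.tangent ∞
      (fun z : B × F => (⟨z.1, V₁ z.1⟩ : TangentBundle I B)) := ContMDiff.comp hV₁ contMDiff_fst
  have h2 : ContMDiff (I.prod J) J.tangent ∞
      (fun z : B × F => (⟨z.2, V₂ z.2⟩ : TangentBundle J F)) := ContMDiff.comp hV₂ contMDiff_snd
  have h3 := (contMDiff_equivTangentBundleProd_symm (n := ∞) (I := I) (M := B) (I' := J)
    (M' := F)).comp (h1.prodMk h2)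
  refine h3.congr fun z => ?_
  have hV : (horizontalLift V₁ z + verticalLift V₂ z : E × E') = (V₁ z.1, V₂ z.2) :=
    Prod.ext (add_zero _) (zero_add _)
  exact congrArg (fun v : E × E' => (⟨z, v⟩ : TangentBundle (I.prod J) (B × F))) hV

variable [I.Boundaryless] [J.Boundaryless] [FiniteDimensional ℝ E] [FiniteDimensional ℝ E']

/-- The rough Laplacian of `V₁ + V₂` on a warped product. -/
theorem roughLaplacian_warpedMetric (gB : Metric I B) (gF : Metric J F)
    (f : B → ℝ) (hf : ContMDiff I 𝓘(ℝ, ℝ) ∞ f) (hpos : ∀ x, 0 < f x)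
    {V₁ : ∀ p : B, TangentSpace I p} (hV₁ : SmoothVectorField V₁)
    {V₂ : ∀ q : F, TangentSpace J q} (hV₂ : SmoothVectorField V₂) (p : B) (q : F) :
    (roughLaplacian (warpedMetric gB gF f hf hpos)
        (fun z => horizontalLift V₁ z + verticalLift V₂ z) (p, q) : E × E') =
      ((roughLaplacian gB V₁ p
          - ((Module.finrank ℝ E' : ℝ) / f p) • covDeriv gB V₁ p (gradient gB f p)
          + (2 / f p * divergence gF V₂ q) • gradient gB f p
          + ((Module.finrank ℝ E' : ℝ) * (dirDeriv f p (V₁ p) / f p ^ 2)) • gradient gB f p : E),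
       ((1 / f p ^ 2) • roughLaplacian gF V₂ q
          + (laplacian gB f p / f p) • V₂ q
          + ((1 - (Module.finrank ℝ E' : ℝ)) *
              (dirDeriv f p (gradient gB f p) / f p ^ 2)) • V₂ q : E')) := by
  let φ : E → ℝ := f ∘ (extChartAt I p).symm
  have hW : IsLocalWarped (chartMetric gB p) φ (chartMetric gF q)
      (extChartAt I p p) (extChartAt J q q) :=
    ⟨isLocalMetric_chartMetric gB p, isLocalMetric_chartMetric gF q, contDiffAt_comp_chart hf p,
      fun _ => hpos _⟩
  have hφ : φ (extChartAt I p p) = f p := congrArg f (extChartAt_to_inv p)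
  have hz : extChartAt (I.prod J) (p, q) (p, q) = (extChartAt I p p, extChartAt J q q) := by
    rw [extChartAt_prod]; rfl
  have hG := chartMetric_warpedMetric gB gF f hf hpos p q
  have hV := chartField_prod V₁ V₂ p q
  have hb := modelBasis_inner (warpedMetric gB gF f hf hpos) (p, q)
  -- The chosen orthonormal basis of the product need not be adapted to the splitting;
  -- `sum_secondNabla` accepts any.
  rw [hz, hG.eq_of_nhds] at hb
  have key := hW.sum_secondNabla (contDiffAt_chartField hV₁ p) (contDiffAt_chartField hV₂ q) _ _ _
    hb (modelBasis_inner gB p) (modelBasis_inner gF q)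
  rw [hφ, Fintype.card_fin, chartField_self, chartField_self] at key
  rw [roughLaplacian_eq, hz, roughLaplacian_eq, roughLaplacian_eq, dirDeriv_eq hf, dirDeriv_eq hf,
    covDeriv_eq, gradient_eq gB hf, divergence_eq, laplacian_eq]
  refine Eq.trans ?_ key
  exact Finset.sum_congr rfl fun i _ => secondNabla_congr hG hV _ _

end Warped

end WarpedHarmonic

end

open WarpedHarmonic in
theorem mainTheorem1
    {E : Type*} [NormedAddCommGroup E] [NormedSpace ℝ E] [FiniteDimensional ℝ E]
    {H : Type*} [TopologicalSpace H] {I : ModelWithCorners ℝ E H} [I.Boundaryless]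
    {B : Type*} [TopologicalSpace B] [T2Space B] [SecondCountableTopology B]
    [ChartedSpace H B] [IsManifold I ∞ B]
    {E' : Type*} [NormedAddCommGroup E'] [NormedSpace ℝ E'] [FiniteDimensional ℝ E']
    {H' : Type*} [TopologicalSpace H'] {J : ModelWithCorners ℝ E' H'} [J.Boundaryless]
    {F : Type*} [TopologicalSpace F] [T2Space F] [SecondCountableTopology F]
    [ChartedSpace H' F] [IsManifold J ∞ F]
    (gB : Metric I B) (gF : Metric J F)
    (f : B → ℝ) (hf : ContMDiff I 𝓘(ℝ, ℝ) ∞ f) (hpos : ∀ x, 0 < f x)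
    (V₁ : ∀ p : B, TangentSpace I p) (hV₁ : SmoothVectorField V₁)
    (V₂ : ∀ q : F, TangentSpace J q) (hV₂ : SmoothVectorField V₂)
    (n : ℕ) (hn : n = Module.finrank ℝ E') :
    IsHarmonicVectorField (warpedMetric gB gF f hf hpos)
        (fun z => horizontalLift V₁ z + verticalLift V₂ z) ↔
      ∀ (p : B) (q : F),
        (roughLaplacian gB V₁ p
            - ((n : ℝ) / f p) • covDeriv gB V₁ p (gradient gB f p)
            + (2 / f p * divergence gF V₂ q) • gradient gB f p
            + ((n : ℝ) * (dirDeriv f p (V₁ p) / f p ^ 2)) • gradient gB f p = 0) ∧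
        ((1 / f p ^ 2) • roughLaplacian gF V₂ q
            + (laplacian gB f p / f p) • V₂ q
            + ((1 - (n : ℝ)) * (dirDeriv f p (gradient gB f p) / f p ^ 2)) • V₂ q = 0) := by
  subst hn
  have key := roughLaplacian_warpedMetric gB gF f hf hpos hV₁ hV₂
  constructor
  · intro h p q
    exact Prod.ext_iff.1 ((key p q).symm.trans (h.2 (p, q)))
  · intro h
    -- Harmonicity includes smoothness of the field, which the two equations do not supply.
    refine ⟨smoothVectorField_lift_add_lift hV₁ hV₂, fun z => ?_⟩
    exact (key z.1 z.2).trans (Prod.ext (h z.1 z.2).1 (h z.1 z.2).2)
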